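/- All graphs are finite and simple. For a graph $G$ with adjacency matrix $A(G)$ over $\mathbb F_2$, the cut-rank of $X\subseteq V(G)$ is $\operatorname{rank} A(G)[X,V(G)\setminus X]$. A tree is subcubic if it has at least two vertices and every vertex that is not a leaf has degree $3$; a tree is a caterpillar if it contains a path $P$ such that every vertex is at distance at most $1$ from $P$. A linear rank-decomposition of $G$ is a pair $(T,L)$ of a subcubic caterpillar tree $T$ and a bijection $L$ from $V(G)$ to the leaves of $T$; its width is the maximum, over the edges $e$ of $T$, of the cut-rank of the set of vertices mapped to one side of $T\setminus e$. The linear rank-width of $G$ is the minimum width of its linear rank-decompositions ($0$ if $|V(G)|\le 1$). Local complementation at $v$ gives the graph $G*v$ obtained by complementing the adjacency between distinct neighbours of $v$; pivoting an edge $uv$ gives $G*u*v*u$; a pivot-minor of $H$ is a graph isomorphic to one obtained from $H$ by a sequence of vertex deletions and pivotings of edges. Let $(T,L)$ be a linear rank-decomposition of a connected graph $G$ with at least three vertices, and $x$ a leaf of $T$; direct the edges of $T$ away from $x$. For $e\in E(T)$ let $A_e$ be the set of vertices of $G$ mapped to the component of $T\setminus e$ not containing $x$, and $B_e=V(G)\setminus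 A_e$. Choose sets $U_e\subseteq A_e$ indexing a basis of the row space of $A(G)[A_e,B_e]$, such that $U_e\cap A_f\subseteq U_f$ whenever the tail of $f$ is the head of $e$, and let $P_e$ be the unique $A_e\times U_e$ matrix with $P_e\,A(G)[U_e,B_e]=A(G)[A_e,B_e]$. The corresponding rank-expansion of $G$ has as vertices the triples $(a,e,v)$ where $v$ is an inner vertex of $T$, $e$ is an edge of $T$ incident with $v$, and $a\in U_e$; its edges are the pairs $(a,e,v)(a,e,w)$ with $e=vw$; the pairs $(a,f,v)(b,e,v)$ where $v$ is the head of $e$ and the tail of $f$ and $(P_e)_{a,b}\ne 0$; and the pairs $(a,f_1,v)(b,f_2,v)$ where $v$ is the tail of the two distinct edges $f_1,f_2$ and $ab\in E(G)$. **Theorem.** (i) A graph $G$ is bipartite and has linear rank-width at most $1$ if and only if $G$ is a pivot-minor of a path. (ii) Let $G$ be a connected bipartite graph with at least three vertices and let $(T,L)$ be a linear rank-decomposition of $G$ of width at most $1$. Then for every leaf $x$ of $T$ a rank-expansion of $G$ with respect to $(T,L)$ and $x$ exists, and every rank-expansion of $G$ with respect to $(T,L)$ is a caterpillar tree of maximum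 degree at most $3$. (iii) Every caterpillar tree of maximum degree at most $3$ is a pivot-minor of a path. -/

import Mathlib

universe u v

namespace RankExpansion

/-! ### Pivot-minors -/

section Minors

variable {V : Type u}

/-- Local complementation `G * v`: complement the adjacency between any two distinct
neighbours of `v`. -/
def localComp (G : SimpleGraph V) (v : V) : SimpleGraph V where
  Adj x y := x ≠ y ∧ Xor (G.Adj x y) (G.Adj x v ∧ G.Adj y v)
  symm := ⟨fun x y h => ⟨h.1.symm, by
    rw [G.adj_comm y x, and_comm (a := G.Adj y v)]
    exact h.2⟩⟩
  loopless := ⟨fun _ h => h.1 rfl⟩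

/-- The graph `G ∧ uv = G * u * v * u`, meaningful when `uv` is an edge of `G`. -/
def pivot (G : SimpleGraph V) (u v : V) : SimpleGraph V :=
  localComp (localComp (localComp G u) v) u

/-- `PivotReduces G H`: the graph `H` is literally obtained from `G` by a (possibly empty)
sequence of pivotings of edges and of vertex deletions. -/
inductive PivotReduces {V : Type u} (G : SimpleGraph V) :
    ∀ {W : Type u}, SimpleGraph W → Prop
  | refl : PivotReduces G G
  | pivot {W : Type u} {H : SimpleGraph W} {a b : W} (h : PivotReduces G H)
      (hab : H.Adj a b) : PivotReduces G (pivot H a b)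
  | delete {W : Type u} {H : SimpleGraph W} (h : PivotReduces G H) (a : W) :
      PivotReduces G (H.induce ({a}ᶜ : Set W))

/-- `H` is (isomorphic to) a pivot-minor of `G`. -/
def IsPivotMinor {W : Type v} (H : SimpleGraph W) (G : SimpleGraph V) : Prop :=
  ∃ (U : Type u) (K : SimpleGraph U), PivotReduces G K ∧ Nonempty (H ≃g K)

/-- `H` is (isomorphic to) a pivot-minor of a path. -/
def IsPivotMinorOfPath (H : SimpleGraph V) : Prop :=
  ∃ n : ℕ, 1 ≤ n ∧ IsPivotMinor H (SimpleGraph.pathGraph n)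

end Minors

/-! ### Subcubic trees and caterpillars -/

section Trees

variable {N : Type u}

/-- The degree of a vertex (all graphs below are finite). -/
noncomputable def deg (T : SimpleGraph N) (t : N) : ℕ := (T.neighborSet t).ncard

/-- A leaf is a vertex of degree one; every other vertex is an inner vertex. -/
def IsLeaf (T : SimpleGraph N) (t : N) : Prop := deg T t = 1

/-- A tree with at least two vertices all of whose inner vertices have degree three. -/
def IsSubcubicTree (T : SimpleGraph N) : Prop :=
  T.IsTree ∧ Nontrivial N ∧ ∀ t, ¬ IsLeaf T t → deg T t = 3

/-- A tree containing a path such that every vertex has distance at most one to it. -/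
def IsCaterpillar (T : SimpleGraph N) : Prop :=
  T.IsTree ∧ ∃ (s t : N) (p : T.Walk s t), p.IsPath ∧ ∀ r, ∃ q ∈ p.support, T.dist r q ≤ 1

end Trees

/-! ### Linear rank-width -/

variable {V : Type u}

open Classical in
/-- The cut-rank `rank A(G)[X, V \ X]` over the binary field. -/
noncomputable def cutRank [Fintype V] (G : SimpleGraph V) (X : Set V) : ℕ :=
  ((G.adjMatrix (ZMod 2)).submatrix
    (Subtype.val : {a // a ∈ X} → V) (Subtype.val : {b // b ∉ X} → V)).rank

/-- A rank-decomposition `(T, L)` of a graph with vertex set `V`. (Every finite tree is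
isomorphic to one with nodes in `Type`.) -/
structure RankDecomposition (V : Type u) where
  Node : Type
  finite_node : Finite Node
  T : SimpleGraph Node
  subcubic : IsSubcubicTree T
  L : V ≃ {t : Node // IsLeaf T t}

namespace RankDecomposition

/-- The vertices of the graph whose leaves lie in the component of `T \ e` containing `s`. -/
def side (D : RankDecomposition V) (e : Sym2 D.Node) (s : D.Node) : Set V :=
  {a | (D.T.deleteEdges {e}).Reachable s (D.L a)}

/-- The width of an edge of the tree, here given with an orientation. Reversing the orientation
replaces the vertex set by its complement, which has the same cut-rank. -/
noncomputable def edgeWidth [Fintype V] (D : RankDecomposition V) (G : SimpleGraph V)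
    (d : D.T.Dart) : ℕ :=
  cutRank G (D.side d.edge d.fst)

/-- The maximum width of an edge of the tree. -/
noncomputable def width [Fintype V] (D : RankDecomposition V) (G : SimpleGraph V) : ℕ :=
  ⨆ d : D.T.Dart, D.edgeWidth G d

/-- A linear rank-decomposition is one whose tree is a caterpillar. -/
def IsLinear (D : RankDecomposition V) : Prop := IsCaterpillar D.T

end RankDecomposition

open Classical in
/-- The minimum width of a linear rank-decomposition, and `0` for at most one vertex. -/
noncomputable def linearRankWidth [Fintype V] (G : SimpleGraph V) : ℕ :=
  if Fintype.card V ≤ 1 then 0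
  else sInf {k | ∃ D : RankDecomposition V, D.IsLinear ∧ D.width G = k}

/-! ### Rank-expansions -/

namespace RankDecomposition

variable (D : RankDecomposition V) (x : D.Node)

/-- `A_e`: the vertices whose leaves are not in the component of `T \ e` containing `x`. -/
def below (e : Sym2 D.Node) : Set V := (D.side e x)ᶜ

/-- `v` is the tail of `e`, where `e` is directed away from `x`. -/
def IsTail (e : Sym2 D.Node) (v : D.Node) : Prop :=
  v ∈ e ∧ (D.T.deleteEdges {e}).Reachable x v

/-- `v` is the head of `e`, where `e` is directed away from `x`. -/
def IsHead (e : Sym2 D.Node) (v : D.Node) : Prop :=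
  v ∈ e ∧ ¬ (D.T.deleteEdges {e}).Reachable x v

open Classical in
/-- The row `R^e_a` of the matrix `A(G)[A_e, B_e]`, where `B_e = V \ A_e`. -/
noncomputable def row (G : SimpleGraph V) (e : Sym2 D.Node) (a : V) :
    {b // b ∉ D.below x e} → ZMod 2 :=
  fun b => G.adjMatrix (ZMod 2) a b

end RankDecomposition

/-- The choices that determine a rank-expansion of `G` with respect to `D = (T, L)`: a leaf `x`
of `T`, and for each edge `e` of `T` a set `U_e ⊆ A_e` indexing a basis of the rows of
`A(G)[A_e, B_e]`, with `U_e ∩ A_f ⊆ U_f` whenever the tail of `f` is the head of `e`. -/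
structure ExpansionData (G : SimpleGraph V) (D : RankDecomposition V) where
  x : D.Node
  isLeaf_x : IsLeaf D.T x
  U : Sym2 D.Node → Finset V
  subset_below : ∀ e ∈ D.T.edgeSet, (U e : Set V) ⊆ D.below x e
  linearIndependent : ∀ e ∈ D.T.edgeSet,
    LinearIndependent (ZMod 2) (fun w : {w // w ∈ U e} => D.row x G e w)
  span : ∀ e ∈ D.T.edgeSet, ∀ a ∈ D.below x e,
    D.row x G e a ∈ Submodule.span (ZMod 2) (D.row x G e '' (U e : Set V))
  nested : ∀ e ∈ D.T.edgeSet, ∀ f ∈ D.T.edgeSet, ∀ v, D.IsHead x e v → D.IsTail x f v →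
    (U e : Set V) ∩ D.below x f ⊆ (U f : Set V)

namespace ExpansionData

variable {G : SimpleGraph V} {D : RankDecomposition V} (R : ExpansionData G D)

/-- The vertices `(a, e, v)` of the rank-expansion: `v` is an inner vertex of `T`, `e` an edge
of `T` at `v`, and `a ∈ U_e`. -/
abbrev Vertex : Type u :=
  {p : V × Sym2 D.Node × D.Node //
    ¬ IsLeaf D.T p.2.2 ∧ p.2.1 ∈ D.T.edgeSet ∧ p.2.2 ∈ p.2.1 ∧ p.1 ∈ R.U p.2.1}

/-- For `a ∈ A_e` and `b ∈ U_e`: the entry `(a, b)` of `P_e` is nonzero, where `P_e` is the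
matrix with `P_e A(G)[U_e, B_e] = A(G)[A_e, B_e]`. Here `c` is row `a` of `P_e`; its restriction
to `U_e` is unique, since the rows indexed by `U_e` are linearly independent. -/
def CoeffNeZero (e : Sym2 D.Node) (a b : V) : Prop :=
  ∃ c : V → ZMod 2, ∑ w ∈ R.U e, c w • D.row R.x G e w = D.row R.x G e a ∧ c b ≠ 0

/-- The three kinds of edges of a rank-expansion, each listed in one direction. -/
inductive Link : R.Vertex → R.Vertex → Prop
  | inner (p q : R.Vertex) (ha : p.1.1 = q.1.1) (he : p.1.2.1 = q.1.2.1)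
      (hv : p.1.2.2 ≠ q.1.2.2) : Link p q
  | through (p q : R.Vertex) (hv : p.1.2.2 = q.1.2.2)
      (hp : D.IsTail R.x p.1.2.1 p.1.2.2) (hq : D.IsHead R.x q.1.2.1 q.1.2.2)
      (hC : R.CoeffNeZero q.1.2.1 p.1.1 q.1.1) : Link p q
  | siblings (p q : R.Vertex) (hv : p.1.2.2 = q.1.2.2) (hne : p.1.2.1 ≠ q.1.2.1)
      (hp : D.IsTail R.x p.1.2.1 p.1.2.2) (hq : D.IsTail R.x q.1.2.1 q.1.2.2)
      (hG : G.Adj p.1.1 q.1.1) : Link p q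

/-- The rank-expansion `R(G, T, L, x, {U_f})`. -/
def graph : SimpleGraph R.Vertex := SimpleGraph.fromRel R.Link

end ExpansionData

end RankExpansion

/-! Rank at most one over the binary field is used in combinatorial form: all nonzero rows across a
cut coincide (`CutLeOne`). Linear rank-width at most one then means that the vertices have an order
all of whose initial segments are such cuts (`IsThin`): the spine edges of the caterpillar cut off
initial segments, and every other edge of it cuts off a single leaf.

Part (i). Paths are bipartite and thin, and pivots and deletions preserve both properties
(`CutLeOne.localComp`, `isBipartite_pivot`). Conversely, a bipartite thin graph is built along its
order inside a pivoted path (`PrefixRealised.succ`). All earlier vertices that still have later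
neighbours have the same ones, so only the set of these vertices has to be remembered; it is stored
as the neighbourhood of one frontier vertex `N` of the path. Bipartiteness excludes the only case
that a pivot could not handle.

Part (iii). A caterpillar of maximum degree at most three is part of a comb
(`exists_isCombEmbedding`), hence bipartite and thin, and part (i) applies.

Part (ii). In a connected graph every relevant cut has rank exactly one, so each `U e` is a
singleton and every inner node of the tree contributes three vertices, one per incident edge.
Exactly two of the three pairs are linked (`exactly_two_of_three`): at least two by connectedness
and the nesting condition, not all three because a bipartite graph has no triangle. So each node
gives a three-vertex path, consecutive nodes are joined by one edge, and such a chain is a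
caterpillar of maximum degree at most three. A rank-expansion exists because representatives can be
chosen recursively away from `x` (`RankDecomposition.exists_representatives`). -/

namespace RankExpansion

/-! ### Cuts of rank at most one and thin orderings. -/

section Cuts

variable {V : Type u} {W : Type v}

/-- The cut between `X` and its complement has rank at most one over the binary field: any two
nonzero rows of the bipartite adjacency matrix are equal. -/
def CutLeOne (G : SimpleGraph V) (X : Set V) : Prop :=
  ∀ ⦃a⦄, a ∈ X → ∀ ⦃a'⦄, a' ∈ X → ∀ ⦃b⦄, b ∉ X → ∀ ⦃b'⦄, b' ∉ X →
    G.Adj a b → G.Adj a' b' → G.Adj a b'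

theorem CutLeOne.compl {G : SimpleGraph V} {X : Set V} (h : CutLeOne G X) : CutLeOne G Xᶜ := by
  intro a ha a' ha' b hb b' hb' h1 h2
  exact (h (not_not.1 hb') (not_not.1 hb) ha' ha h2.symm h1.symm).symm

/-- An injective ordering all of whose initial segments have cut-rank at most one. -/
structure IsThin (G : SimpleGraph V) (f : V → ℕ) : Prop where
  injective : Function.Injective f
  cut : ∀ k, CutLeOne G {a | f a < k}

/-- For `v ∈ X` the operation adds the row of `v` to the rows of its neighbours in `X`, so the row
space does not grow; the other case is the complementary cut. -/
theorem CutLeOne.localComp {G : SimpleGraph V} {X : Set V} (h : CutLeOne G X) (v : V) :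
    CutLeOne (localComp G v) X := by
  wlog hv : v ∈ X generalizing X
  · rw [← compl_compl X]
    exact (this h.compl hv).compl
  intro a ha a' ha' b hb b' hb' h1 h2
  have hab' : a ≠ b' := fun e => hb' (e ▸ ha)
  simp only [RankExpansion.localComp, Xor, G.adj_comm _ v] at h1 h2 ⊢
  refine ⟨hab', ?_⟩
  -- These instances of the rank condition on the rows `a`, `a'`, `v` and the columns `b`, `b'`
  -- leave a propositional check on eight adjacencies.
  have k1 := h ha ha' hb hb'
  have k4 := h ha' ha hb hb'
  have l1 := h ha hv hb hb'
  have l5 := h hv ha hb hb'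
  have l3 := h ha' hv hb hb'
  have l7 := h hv ha' hb hb'
  have l2 := h ha hv hb' hb
  have l6 := h hv ha hb' hb
  have l4 := h ha' hv hb' hb
  have l8 := h hv ha' hb' hb
  have h1 := h1.2
  have h2 := h2.2
  clear hab' ha ha' hb hb' hv h
  generalize G.Adj a b = p1 at *
  generalize G.Adj a b' = p2 at *
  generalize G.Adj a' b = p3 at *
  generalize G.Adj a' b' = p4 at *
  generalize G.Adj v a = p5 at *
  generalize G.Adj v a' = p6 at *
  generalize G.Adj v b = p7 at *
  generalize G.Adj v b' = p8 at *
  by_cases p5 <;> by_cases p6 <;> by_cases p7 <;> by_cases p8 <;> simp_all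

theorem IsThin.pivot {G : SimpleGraph V} {f : V → ℕ} (h : IsThin G f) (a b : V) :
    IsThin (pivot G a b) f :=
  ⟨h.injective, fun k => (((h.cut k).localComp a).localComp b).localComp a⟩

theorem IsThin.comap {G : SimpleGraph V} {f : V → ℕ} (h : IsThin G f) {H : SimpleGraph W}
    (e : H ↪g G) : IsThin H (f ∘ e) := by
  refine ⟨h.injective.comp e.injective, fun k a ha a' ha' b hb b' hb' h1 h2 => ?_⟩
  rw [← e.map_adj_iff] at *
  exact h.cut k (a := e a) ha (a' := e a') ha' hb hb' h1 h2

theorem isThin_pathGraph (n : ℕ) : IsThin (SimpleGraph.pathGraph n) (fun i => (i : ℕ)) := by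
  refine ⟨Fin.val_injective, fun k a ha a' ha' b hb b' hb' h1 h2 => ?_⟩
  simp only [SimpleGraph.pathGraph_adj, Set.mem_ofPred_eq] at *
  omega

end Cuts

/-! ### Pivoting in bipartite graphs, and pivot-minors of paths. -/

section Pivots

variable {V : Type u} {W : Type v}

/-- The adjacency of `G ∧ uv`, if `u` and `v` are adjacent without common neighbours. -/
theorem pivot_adj {G : SimpleGraph V} {u v : V} (huv : G.Adj u v)
    (hno : ∀ w, ¬ (G.Adj u w ∧ G.Adj v w)) (x y : V) :
    (pivot G u v).Adj x y ↔ x ≠ y ∧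
      ((x = u ∧ (y = v ∨ G.Adj v y)) ∨ (y = u ∧ (x = v ∨ G.Adj v x)) ∨
       (x ≠ u ∧ y ≠ u ∧ x = v ∧ G.Adj u y) ∨ (x ≠ u ∧ y ≠ u ∧ y = v ∧ G.Adj u x) ∨
       (x ≠ u ∧ y ≠ u ∧ x ≠ v ∧ y ≠ v ∧
        Xor (G.Adj x y) ((G.Adj u x ∧ G.Adj v y) ∨ (G.Adj u y ∧ G.Adj v x)))) := by
  have hne := huv.ne
  have hvu := huv.symm
  have hx := hno x
  have hy := hno y
  have h1 := G.irrefl (v := u)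
  have h2 := G.irrefl (v := v)
  simp only [pivot, localComp, Xor]
  by_cases hxy : x = y
  · subst hxy; simp
  by_cases hxu : x = u
  · subst hxu
    by_cases hyv : y = v
    · subst hyv; simp [huv, hvu, hne, hne.symm]
    by_cases p1 : G.Adj x y <;> by_cases p2 : G.Adj v y <;>
      simp_all [eq_comm, G.adj_comm y x, G.adj_comm y v]
  by_cases hyu : y = u
  · subst hyu
    by_cases hxv : x = v
    · subst hxv; simp [huv, hvu, hne, hne.symm]
    by_cases p1 : G.Adj y x <;> by_cases p2 : G.Adj v x <;>
      simp_all [eq_comm, G.adj_comm x y, G.adj_comm x v]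
  by_cases hxv : x = v
  · subst hxv
    by_cases p1 : G.Adj u y <;> by_cases p2 : G.Adj x y <;>
      simp_all [eq_comm, G.adj_comm y u, G.adj_comm y x]
  by_cases hyv : y = v
  · subst hyv
    by_cases p1 : G.Adj u x <;> by_cases p2 : G.Adj y x <;>
      simp_all [eq_comm, G.adj_comm x u, G.adj_comm x y]
  rw [G.adj_comm x u, G.adj_comm x v, G.adj_comm y u, G.adj_comm y v]
  by_cases p5 : G.Adj u x <;> by_cases p6 : G.Adj u y <;> by_cases p7 : G.Adj v x <;>
    by_cases p8 : G.Adj v y <;> simp_all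

theorem isBipartite_iff_exists_coloring {G : SimpleGraph V} :
    G.IsBipartite ↔ ∃ c : V → Prop, ∀ x y, G.Adj x y → (c x ↔ ¬ c y) := by
  constructor
  · rintro ⟨C⟩
    refine ⟨fun x => C x = 0, fun x y h => ?_⟩
    have : ∀ p q : Fin 2, p ≠ q → (p = 0 ↔ ¬ q = 0) := by decide
    exact this _ _ (C.valid h)
  · rintro ⟨c, hc⟩
    classical
    exact ⟨SimpleGraph.Coloring.mk (fun x => if c x then 0 else 1) fun {x y} h => by
      have := hc x y h
      by_cases hx : c x <;> by_cases hy : c y <;> simp_all⟩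

/-- The vertices `u` and `v` exchange their neighbourhoods, so they exchange colours; the other
toggled pairs join a neighbour of `u` to a neighbour of `v`, which have opposite colours. -/
theorem isBipartite_pivot {G : SimpleGraph V} (hG : G.IsBipartite) {u v : V} (huv : G.Adj u v) :
    (pivot G u v).IsBipartite := by
  rw [isBipartite_iff_exists_coloring] at *
  obtain ⟨c, hc⟩ := hG
  have h1 := hc _ _ huv
  refine ⟨fun x => (¬ (x = u ∨ x = v) ∧ c x) ∨ ((x = u ∨ x = v) ∧ ¬ c x), fun x y h => ?_⟩
  rw [pivot_adj huv fun w h => by have := hc _ _ h.1; have := hc _ _ h.2; tauto] at h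
  obtain ⟨hxy, ⟨rfl, rfl | h⟩ | ⟨rfl, rfl | h⟩ | ⟨h7, h8, rfl, h⟩ | ⟨h7, h8, rfl, h⟩ |
    ⟨h7, h8, h9, h10, h⟩⟩ := h
  · simp [h1]
  · by_cases hy : y = v
    · simp [hy] at h
    · simp [hxy.symm, hy, h1, hc _ _ h]
  · simp [h1]
  · by_cases hx : x = v
    · simp [hx] at h
    · simp [hxy, hx, h1, hc _ _ h]
  · have := hc _ _ h
    simp only [h8, hxy.symm, or_true, or_false, not_true, not_false_iff, false_and, true_and,
      false_or]
    clear hc h7 h8 hxy huv h; tauto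
  · have := hc _ _ h
    simp only [h7, hxy, or_true, or_false, not_true, not_false_iff, false_and, true_and, false_or]
    clear hc h7 h8 hxy huv h; tauto
  · simp only [h7, h8, h9, h10, or_false, not_false_iff, false_and, true_and]
    rcases h with ⟨h, -⟩ | ⟨⟨h, h'⟩ | ⟨h, h'⟩, -⟩
    · exact hc _ _ h
    · rw [← not_iff_not, ← hc _ _ h, h1, hc _ _ h']
    · have e1 := hc _ _ h
      have e2 := hc _ _ h'
      clear hc h7 h8 h9 h10 hxy huv h h'; tauto

theorem not_adj_of_isBipartite {G : SimpleGraph V} (hG : G.IsBipartite) {a b c : V}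
    (h1 : G.Adj a b) (h2 : G.Adj b c) : ¬ G.Adj a c := by
  obtain ⟨d, hd⟩ := isBipartite_iff_exists_coloring.1 hG
  intro h3
  have := hd _ _ h1
  have := hd _ _ h2
  have := hd _ _ h3
  tauto

theorem isBipartite_of_embedding {G : SimpleGraph V} {H : SimpleGraph W} (e : H ↪g G)
    (hG : G.IsBipartite) : H.IsBipartite := by
  obtain ⟨c, hc⟩ := isBipartite_iff_exists_coloring.1 hG
  exact isBipartite_iff_exists_coloring.2 ⟨c ∘ e, fun x y h => hc _ _ (e.map_adj_iff.2 h)⟩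

theorem isBipartite_pathGraph (n : ℕ) : (SimpleGraph.pathGraph n).IsBipartite := by
  refine isBipartite_iff_exists_coloring.2 ⟨fun i => (i : ℕ) % 2 = 0, fun x y h => ?_⟩
  rw [SimpleGraph.pathGraph_adj] at h
  omega

theorem PivotReduces.bipartite_thin {G : SimpleGraph V} (hG : G.IsBipartite)
    (hf : ∃ f, IsThin G f) {W : Type u} {H : SimpleGraph W} (h : PivotReduces G H) :
    H.IsBipartite ∧ ∃ f, IsThin H f := by
  induction h with
  | refl => exact ⟨hG, hf⟩
  | pivot h hab ih =>
    obtain ⟨h1, f, h2⟩ := ih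
    exact ⟨isBipartite_pivot h1 hab, f, h2.pivot _ _⟩
  | delete h a ih =>
    obtain ⟨h1, f, h2⟩ := ih
    exact ⟨isBipartite_of_embedding (SimpleGraph.Embedding.induce _) h1, _,
      h2.comap (SimpleGraph.Embedding.induce _)⟩

theorem IsPivotMinorOfPath.bipartite_thin {H : SimpleGraph V} (h : IsPivotMinorOfPath H) :
    H.IsBipartite ∧ ∃ f, IsThin H f := by
  obtain ⟨n, -, U, K, hK, ⟨e⟩⟩ := h
  obtain ⟨h1, f, h2⟩ := hK.bipartite_thin (isBipartite_pathGraph n) ⟨_, isThin_pathGraph n⟩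
  exact ⟨isBipartite_of_embedding e.toEmbedding h1, _, h2.comap e.toEmbedding⟩

/-- One pivoting of an edge. -/
def PivotStep (G H : SimpleGraph V) : Prop := ∃ a b, G.Adj a b ∧ H = pivot G a b

theorem PivotReduces.of_steps {G K : SimpleGraph V} (h : Relation.ReflTransGen PivotStep G K) :
    PivotReduces G K := by
  induction h with
  | refl => exact .refl
  | tail _ h ih =>
    obtain ⟨a, b, hab, rfl⟩ := h
    exact .pivot ih hab

/-- Deletions remove one vertex at a time and change the vertex type, hence the induction on the
number of vertices outside `S`. -/
theorem PivotReduces.exists_induce {G : SimpleGraph V} (n : ℕ) :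
    ∀ {W : Type u} [Finite W] {H : SimpleGraph W}, PivotReduces G H → ∀ S : Set W,
      Sᶜ.ncard = n → ∃ (U : Type u) (K : SimpleGraph U), PivotReduces G K ∧
        Nonempty (H.induce S ≃g K) := by
  induction n with
  | zero =>
    intro W _ H h S hS
    rw [Set.ncard_eq_zero, Set.compl_empty_iff] at hS
    subst hS
    exact ⟨W, H, h, ⟨SimpleGraph.induceUnivIso H⟩⟩
  | succ n ih =>
    intro W _ H h S hS
    obtain ⟨a, ha⟩ : Sᶜ.Nonempty := by
      rw [← Set.ncard_pos]; omega
    have hSa : ∀ x ∈ S, x ∈ ({a}ᶜ : Set W) := fun x hx hxa => ha (hxa ▸ hx)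
    obtain ⟨U, K, hK, ⟨e⟩⟩ := ih (h.delete a) (Subtype.val ⁻¹' S) (by
      have h1 : (Subtype.val '' ((Subtype.val ⁻¹' S : Set ({a}ᶜ : Set W))ᶜ)) = Sᶜ \ {a} := by
        ext x
        simp only [Set.mem_image, Set.mem_compl_iff, Set.mem_preimage, Subtype.exists,
          Set.mem_singleton_iff, Set.mem_sdiff]
        grind
      rw [← Set.ncard_image_of_injective _ Subtype.val_injective, h1,
        Set.ncard_sdiff_singleton_of_mem ha, hS]
      rfl)
    refine ⟨U, K, hK, ⟨RelIso.trans ?_ e⟩⟩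
    refine ⟨⟨fun x => ⟨⟨x.1, hSa _ x.2⟩, x.2⟩, fun x => ⟨x.1.1, x.2⟩, fun _ => rfl, fun _ => rfl⟩, ?_⟩
    intro x y
    rfl

theorem IsPivotMinorOfPath.of_steps {n : ℕ} (hn : 1 ≤ n) {K : SimpleGraph (Fin n)}
    (hK : Relation.ReflTransGen PivotStep (SimpleGraph.pathGraph n) K) {H : SimpleGraph V}
    (e : H ↪g K) : IsPivotMinorOfPath H := by
  obtain ⟨U, K', hK', ⟨i⟩⟩ := (PivotReduces.of_steps hK).exists_induce _ (Set.range e) rfl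
  refine ⟨n, hn, U, K', hK', ⟨RelIso.trans ⟨Equiv.ofInjective e e.injective, ?_⟩ i⟩⟩
  intro x y
  exact e.map_adj_iff

theorem pivot_comap (K : SimpleGraph W) (f : V → W) (hf : Function.Injective f) (a b : V) :
    pivot (K.comap f) a b = (pivot K (f a) (f b)).comap f := by
  ext x y
  simp only [pivot, localComp, SimpleGraph.comap_adj, hf.ne_iff]

end Pivots

/-! ### Paths with an untouched tail, and the effect of a pivot at the frontier. -/

section Thin

/-- Beyond the vertex `N` the graph `K` is the one-way infinite path. -/
def HasTail (K : SimpleGraph ℕ) (N : ℕ) : Prop :=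
  ∀ i j, N < j → (K.Adj i j ↔ i + 1 = j ∨ j + 1 = i)

/-- `K` restricts to graphs that are obtained from finite paths by pivoting. -/
def IsPivotedPath (K : SimpleGraph ℕ) (N : ℕ) : Prop :=
  ∀ n, N < n → Relation.ReflTransGen PivotStep (SimpleGraph.pathGraph n)
    (K.comap (Fin.val : Fin n → ℕ))

theorem IsPivotedPath.mono {K : SimpleGraph ℕ} {N M : ℕ} (h : IsPivotedPath K N) (hM : N ≤ M) :
    IsPivotedPath K M := fun n hn => h n (by omega)

theorem HasTail.mono {K : SimpleGraph ℕ} {N M : ℕ} (h : HasTail K N) (hM : N ≤ M) :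
    HasTail K M := fun i j hj => h i j (by omega)

theorem IsPivotedPath.pivot {K : SimpleGraph ℕ} {N : ℕ} (h : IsPivotedPath K N)
    (hT : HasTail K N) : IsPivotedPath (pivot K N (N + 1)) (N + 2) := by
  intro n hn
  refine (h n (by omega)).tail ⟨⟨N, by omega⟩, ⟨N + 1, by omega⟩, ?_, ?_⟩
  · exact (hT N (N + 1) (by omega)).2 (by simp)
  · rw [pivot_comap _ _ Fin.val_injective]

/-- Since `N + 1` has only the neighbours `N` and `N + 2`, the pivot hands the set stored at `N` to
both `N + 1` and `N + 2` and detaches `N` from it. Having two copies lets one become a vertex of the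
target graph while the other stays on the frontier. -/
theorem HasTail.pivot_adj {K : SimpleGraph ℕ} {N : ℕ} (hT : HasTail K N) (x y : ℕ) :
    (pivot K N (N + 1)).Adj x y ↔ x ≠ y ∧
      ((x = N ∧ (y = N + 1 ∨ y = N + 2)) ∨ (y = N ∧ (x = N + 1 ∨ x = N + 2)) ∨
       (x < N ∧ (y = N + 1 ∨ y = N + 2) ∧ K.Adj x N) ∨
       (y < N ∧ (x = N + 1 ∨ x = N + 2) ∧ K.Adj y N) ∨
       (x < N ∧ y < N ∧ K.Adj x y) ∨ (N + 2 ≤ x ∧ N + 2 ≤ y ∧ (x + 1 = y ∨ y + 1 = x))) := by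
  have hN : ∀ z, K.Adj (N + 1) z ↔ z = N ∨ z = N + 2 := fun z => by
    rw [K.adj_comm, hT z (N + 1) (by omega)]; omega
  have hN' : ∀ z, N < z → (K.Adj N z ↔ z = N + 1) := fun z hz => by
    rw [hT N z hz]; omega
  have hNN : ¬ K.Adj N N := K.irrefl
  rw [RankExpansion.pivot_adj ((hN N).2 (Or.inl rfl)).symm]
  · have hxy := hT x y
    have hyx := hT y x
    rw [K.adj_comm y x] at hyx
    have hx := hN' x
    have hy := hN' y
    rw [K.adj_comm x N, K.adj_comm y N]
    simp only [hN, Xor]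
    have key : ∀ z, (z < N ∧ z ≠ N ∧ z ≠ N + 1 ∧ z ≠ N + 2 ∧ ¬ N + 2 ≤ z) ∨
        z = N ∨ z = N + 1 ∨ z = N + 2 ∨
        (N < z ∧ ¬ z < N ∧ z ≠ N ∧ z ≠ N + 1 ∧ z ≠ N + 2 ∧ N + 2 ≤ z) := by omega
    rcases key x with ⟨h1, h2, h3, h4, h5⟩ | rfl | rfl | rfl | ⟨h1, h2, h3, h4, h5, h6⟩ <;>
    rcases key y with ⟨k1, k2, k3, k4, k5⟩ | rfl | rfl | rfl | ⟨k1, k2, k3, k4, k5, k6⟩ <;>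
    first
    | omega
    | (simp [*]; done)
    | (simp [*]; omega)
    | (simp [*]; by_cases p : K.Adj N x <;> simp [p] <;> omega)
    | (simp [*]; by_cases p : K.Adj N y <;> simp [p] <;> omega)
  · rintro w ⟨h1, h2⟩
    rw [hN] at h2
    rcases h2 with rfl | rfl
    · exact hNN h1
    · rw [hN' _ (by omega)] at h1; omega

variable {V : Type u} {G : SimpleGraph V} {f : V → ℕ}

/-- The vertices before `k` are realised in a pivoted path below `N`, where `N` is adjacent to
those vertices which have a neighbour from `k` on. -/
def PrefixRealised (G : SimpleGraph V) (f : V → ℕ) (k : ℕ) : Prop :=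
  ∃ (K : SimpleGraph ℕ) (N : ℕ) (g : V → ℕ), HasTail K N ∧ IsPivotedPath K N ∧
    (∀ a, f a < k → g a < N) ∧ (∀ a b, f a < k → f b < k → g a = g b → a = b) ∧
    (∀ a b, f a < k → f b < k → (K.Adj (g a) (g b) ↔ G.Adj a b)) ∧
    ∀ a, f a < k → (K.Adj (g a) N ↔ ∃ b, k ≤ f b ∧ G.Adj a b)

end Thin

/-! ### Realising a thin bipartite graph inside a pivoted path. -/

section ThinRealisation

variable {V : Type u} {G : SimpleGraph V} {f : V → ℕ}

theorem hasTail_of_pivot {K : SimpleGraph ℕ} {N : ℕ} (hT : HasTail K N) :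
    HasTail (pivot K N (N + 1)) (N + 2) := by
  intro i j hj
  rw [hT.pivot_adj]
  omega

/-- Adding one vertex `v` at position `k`, which becomes the vertex `t` of the new pivoted
path. -/
theorem PrefixRealised.extend {k : ℕ} {K K' : SimpleGraph ℕ} {N M t : ℕ} {g : V → ℕ} {v : V}
    (hf : Function.Injective f) (hv : f v = k)
    (hT : HasTail K' M) (hP : IsPivotedPath K' M) (hNt : N ≤ t) (htM : t < M)
    (hg : ∀ a, f a < k → g a < N)
    (hinj : ∀ a b, f a < k → f b < k → g a = g b → a = b)
    (hadj : ∀ a b, f a < k → f b < k → (K.Adj (g a) (g b) ↔ G.Adj a b))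
    (hold : ∀ i j, i < N → j < N → (K'.Adj i j ↔ K.Adj i j))
    (hnew : ∀ a, f a < k → (K'.Adj (g a) t ↔ G.Adj a v))
    (hM : ∀ a, f a < k → (K'.Adj (g a) M ↔ ∃ b, k + 1 ≤ f b ∧ G.Adj a b))
    (htM' : K'.Adj t M ↔ ∃ b, k + 1 ≤ f b ∧ G.Adj v b) :
    PrefixRealised G f (k + 1) := by
  classical
  have hne : ∀ a, f a < k → a ≠ v := fun a ha e => by rw [e, hv] at ha; exact lt_irrefl _ ha
  have hcase : ∀ a, f a < k + 1 → f a < k ∨ a = v := fun a ha =>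
    (Nat.lt_succ_iff_lt_or_eq.1 ha).imp_right fun h => hf (h.trans hv.symm)
  refine ⟨K', M, fun a => if a = v then t else g a, hT, hP, fun a ha => ?_, fun a b ha hb h => ?_,
    fun a b ha hb => ?_, fun a ha => ?_⟩
  · rcases hcase a ha with h | rfl
    · have := hg a h
      simp only [hne a h, if_false]; omega
    · simpa using htM
  · rcases hcase a ha with h1 | rfl <;> rcases hcase b hb with h2 | rfl
    · simp only [hne a h1, hne b h2, if_false] at h
      exact hinj _ _ h1 h2 h
    · have := hg a h1
      simp only [hne a h1, if_false, if_true] at h; omega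
    · have := hg b h2
      simp only [hne b h2, if_false, if_true] at h; omega
    · rfl
  · rcases hcase a ha with h1 | rfl <;> rcases hcase b hb with h2 | rfl
    · simp only [hne a h1, hne b h2, if_false]
      rw [hold _ _ (hg a h1) (hg b h2), hadj _ _ h1 h2]
    · simp only [hne a h1, if_false, if_true]
      exact hnew a h1
    · simp only [hne b h2, if_false, if_true]
      rw [K'.adj_comm, G.adj_comm]
      exact hnew b h2
    · simp
  · rcases hcase a ha with h1 | rfl
    · simp only [hne a h1, if_false]
      exact hM a h1
    · simpa using htM'

/-- Three questions decide how the new vertex `v` is placed: whether it has an earlier neighbour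
(`hA`), whether an earlier vertex has a neighbour after `v` (`hR`), and whether `v` has a later
neighbour (`hQ`). A pivot is needed only when the stored set must survive, that is, under `hR`. -/
theorem PrefixRealised.succ (hG : G.IsBipartite) (hf : IsThin G f)
    (hiso : ∀ a, ∃ b, G.Adj a b) {k : ℕ} (h : PrefixRealised G f k) :
    PrefixRealised G f (k + 1) := by
  obtain ⟨K, N, g, hT, hP, hg, hinj, hadj, hN⟩ := h
  by_cases hv : ∃ v, f v = k
  swap
  · have hlt : ∀ a, f a < k + 1 ↔ f a < k := fun a => by
      have : f a ≠ k := fun e => hv ⟨a, e⟩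
      omega
    have hle : ∀ a, k ≤ f a ↔ k + 1 ≤ f a := fun a => by
      have : f a ≠ k := fun e => hv ⟨a, e⟩
      omega
    refine ⟨K, N, g, hT, hP, ?_⟩
    simp only [hlt, ← hle]
    exact ⟨hg, hinj, hadj, hN⟩
  obtain ⟨v, hv⟩ := hv
  have hcut : ∀ {a a' b b'}, f a < k → f a' < k → k ≤ f b → k ≤ f b' → G.Adj a b → G.Adj a' b' →
      G.Adj a b' := fun ha ha' hb hb' => hf.cut k ha ha' (not_lt.2 hb) (not_lt.2 hb')
  have hcut' : ∀ {a a' b b'}, f a < k + 1 → f a' < k + 1 → k + 1 ≤ f b → k + 1 ≤ f b' →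
      G.Adj a b → G.Adj a' b' → G.Adj a b' :=
    fun ha ha' hb hb' => hf.cut (k + 1) ha ha' (not_lt.2 hb) (not_lt.2 hb')
  have hext := fun K' M t => PrefixRealised.extend (G := G) (K := K) (K' := K') (M := M) (t := t)
    (N := N) (g := g) hf.injective hv
  -- Earlier vertices with a later neighbour have the same later neighbours, so a single edge to `v`
  -- means that `v` sees the whole set stored at `N`. In the same way `hpers` says that the stored
  -- set persists entirely if any part of it does.
  have hadjv : (∃ a, f a < k ∧ G.Adj a v) → ∀ a, f a < k → (G.Adj a v ↔ K.Adj (g a) N) := by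
    rintro ⟨c, hc, hcv⟩ a ha
    rw [hN a ha]
    exact ⟨fun h => ⟨v, hv.ge, h⟩, fun ⟨b, hb, h⟩ => hcut ha hc hb hv.ge h hcv⟩
  have hpers : (∃ a, f a < k ∧ ∃ b, k + 1 ≤ f b ∧ G.Adj a b) → ∀ a, f a < k →
      ((∃ b, k + 1 ≤ f b ∧ G.Adj a b) ↔ K.Adj (g a) N) := by
    rintro ⟨c, hc, d, hd, hcd⟩ a ha
    rw [hN a ha]
    exact ⟨fun ⟨b, hb, h⟩ => ⟨b, by omega, h⟩,
      fun ⟨b, hb, h⟩ => ⟨d, hd, hcut ha hc hb (by omega) h hcd⟩⟩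
  have hpiv : ∀ i j, i < N → j < N → ((pivot K N (N + 1)).Adj i j ↔ K.Adj i j) := by
    intro i j hi hj
    rw [hT.pivot_adj]
    have : K.Adj i j → i ≠ j := fun h => h.ne
    have e : i ≠ N ∧ i ≠ N + 1 ∧ i ≠ N + 2 ∧ j ≠ N ∧ j ≠ N + 1 ∧ j ≠ N + 2 := by omega
    simp only [e, hi, hj, false_and, false_or, true_and, and_false, or_false]
    constructor
    · rintro ⟨-, h | h⟩
      · exact h
      · omega
    · exact fun h => ⟨this h, Or.inl h⟩
  have hpivN : ∀ a, f a < k → ¬ (pivot K N (N + 1)).Adj (g a) N := by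
    intro a ha
    have := hg a ha
    rw [hT.pivot_adj]; omega
  have hpiv1 : ∀ a, f a < k → ((pivot K N (N + 1)).Adj (g a) (N + 1) ↔ K.Adj (g a) N) := by
    intro a ha
    have := hg a ha
    rw [hT.pivot_adj]
    by_cases p : K.Adj (g a) N <;> simp [p] <;> omega
  have hpiv2 : ∀ a, f a < k → ((pivot K N (N + 1)).Adj (g a) (N + 2) ↔ K.Adj (g a) N) := by
    intro a ha
    have := hg a ha
    rw [hT.pivot_adj]
    by_cases p : K.Adj (g a) N <;> simp [p] <;> omega
  have htail1 : ∀ a, f a < k → ¬ K.Adj (g a) (N + 1) := by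
    intro a ha
    have := hg a ha
    rw [hT _ _ (by omega)]; omega
  have htail2 : ∀ a, f a < k → ¬ K.Adj (g a) (N + 2) := by
    intro a ha
    have := hg a ha
    rw [hT _ _ (by omega)]; omega
  by_cases hA : ∃ a, f a < k ∧ G.Adj a v <;>
  by_cases hR : ∃ a, f a < k ∧ ∃ b, k + 1 ≤ f b ∧ G.Adj a b <;>
  by_cases hQ : ∃ b, k + 1 ≤ f b ∧ G.Adj v b
  -- Here `c` and `v` are adjacent and, by the rank condition after `v`, share the later neighbour
  -- `b`: a triangle.
  · obtain ⟨c, hc, d, hd, hcd⟩ := hR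
    obtain ⟨b, hb, hvb⟩ := hQ
    have hcv := (hadjv hA c hc).2 ((hN c hc).2 ⟨d, by omega, hcd⟩)
    exact absurd (hcut' (by omega) (by omega) hd hb hcd hvb)
      (not_adj_of_isBipartite hG hcv hvb)
  -- One copy of the stored set goes to `v`, the other to the new frontier `N + 2`, which is not
  -- adjacent to `N + 1`; the vertex `N` is discarded.
  · refine hext (pivot K N (N + 1)) (N + 2) (N + 1) (hasTail_of_pivot hT) (hP.pivot hT) (by omega)
      (by omega) hg hinj hadj hpiv (fun a ha => ?_) (fun a ha => ?_) ?_
    · rw [hpiv1 a ha, hadjv hA a ha]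
    · rw [hpiv2 a ha, hpers hR a ha]
    · rw [hT.pivot_adj]
      exact iff_of_false (by omega) hQ
  -- The old set is used up by `v`, which takes the place `N`; the next path vertex stores `v`
  -- alone.
  · refine hext K (N + 1) N (hT.mono (by omega)) (hP.mono (by omega)) (by omega)
      (by omega) hg hinj hadj (fun _ _ _ _ => Iff.rfl) (fun a ha => ?_) (fun a ha => ?_) ?_
    · rw [hadjv hA a ha]
    · exact iff_of_false (htail1 a ha) fun h => hR ⟨a, ha, h⟩
    · exact iff_of_true ((hT _ _ (by omega)).2 (by omega)) hQ
  -- Nothing remains to be stored, so `N + 1` is skipped to obtain a frontier without earlier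
  -- neighbours.
  · refine hext K (N + 2) N (hT.mono (by omega)) (hP.mono (by omega)) (by omega)
      (by omega) hg hinj hadj (fun _ _ _ _ => Iff.rfl) (fun a ha => ?_) (fun a ha => ?_) ?_
    · rw [hadjv hA a ha]
    · exact iff_of_false (htail2 a ha) fun h => hR ⟨a, ha, h⟩
    · exact iff_of_false (by rw [hT _ _ (by omega)]; omega) hQ
  -- The pivot detaches `N` from the prefix, so `N` can serve as `v`, and `N + 2` sees both the
  -- stored set and `v`.
  · refine hext (pivot K N (N + 1)) (N + 2) N (hasTail_of_pivot hT) (hP.pivot hT) (by omega)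
      (by omega) hg hinj hadj hpiv (fun a ha => ?_) (fun a ha => ?_) ?_
    · exact iff_of_false (hpivN a ha) fun h => hA ⟨a, ha, h⟩
    · rw [hpiv2 a ha, hpers hR a ha]
    · rw [hT.pivot_adj]
      exact iff_of_true (by omega) hQ
  · obtain ⟨b, hb⟩ := hiso v
    rcases lt_trichotomy (f b) k with h | h | h
    · exact absurd ⟨b, h, hb.symm⟩ hA
    · exact absurd (hf.injective (h.trans hv.symm)) hb.ne'
    · exact absurd ⟨b, h, hb⟩ hQ
  -- The vertex `v` starts afresh: `N` is skipped, so that `v` is adjacent to nothing earlier.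
  · refine hext K (N + 2) (N + 1) (hT.mono (by omega)) (hP.mono (by omega)) (by omega)
      (by omega) hg hinj hadj (fun _ _ _ _ => Iff.rfl) (fun a ha => ?_) (fun a ha => ?_) ?_
    · exact iff_of_false (htail1 a ha) fun h => hA ⟨a, ha, h⟩
    · exact iff_of_false (htail2 a ha) fun h => hR ⟨a, ha, h⟩
    · exact iff_of_true ((hT _ _ (by omega)).2 (by omega)) hQ
  · obtain ⟨b, hb⟩ := hiso v
    rcases lt_trichotomy (f b) k with h | h | h
    · exact absurd ⟨b, h, hb.symm⟩ hA
    · exact absurd (hf.injective (h.trans hv.symm)) hb.ne'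
    · exact absurd ⟨b, h, hb⟩ hQ

theorem prefixRealised (hG : G.IsBipartite) (hf : IsThin G f) (hiso : ∀ a, ∃ b, G.Adj a b)
    (k : ℕ) : PrefixRealised G f k := by
  induction k with
  | zero =>
    refine ⟨SimpleGraph.fromRel fun i j => i + 1 = j, 0, fun _ => 0, ?_, ?_, by simp, by simp,
      by simp, by simp⟩
    · intro i j hj
      simp only [SimpleGraph.fromRel_adj]; omega
    · intro n hn
      have : SimpleGraph.pathGraph n =
          (SimpleGraph.fromRel fun i j : ℕ => i + 1 = j).comap (Fin.val : Fin n → ℕ) := by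
        ext i j
        simp only [SimpleGraph.pathGraph_adj, SimpleGraph.comap_adj, SimpleGraph.fromRel_adj]
        omega
      rw [this]
  | succ k ih => exact ih.succ hG hf hiso

theorem IsThin.isPivotMinorOfPath [Finite V] (hG : G.IsBipartite) (hf : IsThin G f) :
    IsPivotMinorOfPath G := by
  classical
  let S : Set V := {a | ∃ b, G.Adj a b}
  let e : G.induce S ↪g G := SimpleGraph.Embedding.induce S
  obtain ⟨B, hB⟩ := (Set.finite_range f).bddAbove
  have hB : ∀ a, f a ≤ B := fun a => hB ⟨a, rfl⟩
  obtain ⟨K, N, g, hT, hP, hg, hinj, hadj, -⟩ := prefixRealised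
    (isBipartite_of_embedding e hG) (hf.comap e)
    (fun ⟨a, b, hab⟩ => ⟨⟨b, a, hab.symm⟩, hab⟩) (B + 1)
  have hlt : ∀ a : S, (f ∘ e) a < B + 1 := fun a => Nat.lt_succ_of_le (hB _)
  have hg := fun a => hg a (hlt a)
  have hinj := fun a b => hinj a b (hlt a) (hlt b)
  have hadj := fun a b => hadj a b (hlt a) (hlt b)
  -- The inductive construction needs every vertex to have a neighbour, so isolated vertices are
  -- placed on the tail. The offset `N + 1` keeps them away from the vertices below `N`, and the
  -- factor `2` keeps them pairwise nonadjacent.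
  let φ : V → ℕ := fun a => if h : a ∈ S then g ⟨a, h⟩ else N + 1 + 2 * f a
  have hφ1 : ∀ a (h : a ∈ S), φ a = g ⟨a, h⟩ := fun a h => dif_pos h
  have hφ2 : ∀ a, a ∉ S → φ a = N + 1 + 2 * f a := fun a h => dif_neg h
  have hφlt : ∀ a, φ a < N + 2 + 2 * B := by
    intro a
    have := hB a
    by_cases h : a ∈ S
    · rw [hφ1 a h]; have := hg ⟨a, h⟩; omega
    · rw [hφ2 a h]; omega
  have hφadj : ∀ a b, K.Adj (φ a) (φ b) ↔ G.Adj a b := by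
    intro a b
    by_cases ha : a ∈ S
    · by_cases hb : b ∈ S
      · rw [hφ1 a ha, hφ1 b hb, hadj]
        rfl
      · rw [hφ1 a ha, hφ2 b hb, hT _ _ (by omega)]
        have := hg ⟨a, ha⟩
        exact iff_of_false (by omega) fun h => hb ⟨a, h.symm⟩
    · refine iff_of_false ?_ fun h => ha ⟨b, h⟩
      rw [hφ2 a ha, K.adj_comm, hT _ _ (by omega)]
      by_cases hb : b ∈ S
      · rw [hφ1 b hb]
        have := hg ⟨b, hb⟩
        omega
      · rw [hφ2 b hb]; omega
  have hφinj : Function.Injective φ := by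
    intro a b hab
    by_cases ha : a ∈ S <;> by_cases hb : b ∈ S
    · rw [hφ1 a ha, hφ1 b hb] at hab
      exact congrArg Subtype.val (hinj _ _ hab)
    · rw [hφ1 a ha, hφ2 b hb] at hab
      have := hg ⟨a, ha⟩
      omega
    · rw [hφ2 a ha, hφ1 b hb] at hab
      have := hg ⟨b, hb⟩
      omega
    · rw [hφ2 a ha, hφ2 b hb] at hab
      exact hf.injective (by omega)
  exact IsPivotMinorOfPath.of_steps (by omega) (hP (N + 2 + 2 * B) (by omega))
    ⟨⟨fun a => ⟨φ a, hφlt a⟩, fun a b h => hφinj (congrArg Fin.val h)⟩, hφadj _ _⟩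

end ThinRealisation

/-! ### Edge cuts, bridges and paths in trees. -/

section Trees

variable {N : Type u} {T : SimpleGraph N}

/-- `C` is a vertex set which `uv` leaves, and no other edge. -/
def IsEdgeCut (T : SimpleGraph N) (C : Set N) (u v : N) : Prop :=
  u ∈ C ∧ v ∉ C ∧ ∀ x y, T.Adj x y → x ∈ C → y ∉ C → x = u ∧ y = v

/-- A walk from `u` changes sides only along `uv`, and arrives there at an end of that edge; hence
without `uv` every vertex is still reachable from the end on its own side. -/
theorem IsEdgeCut.reachable_iff {C : Set N} {u v : N} (hC : IsEdgeCut T C u v)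
    (hT : T.Connected) (t t' : N) :
    (T.deleteEdges {s(u, v)}).Reachable t t' ↔ (t ∈ C ↔ t' ∈ C) := by
  obtain ⟨hu, hv, hC⟩ := hC
  have key : ∀ w, (w ∈ C → (T.deleteEdges {s(u, v)}).Reachable u w) ∧
      (w ∉ C → (T.deleteEdges {s(u, v)}).Reachable v w) := by
    intro w
    have hw := (T.reachable_iff_reflTransGen u w).1 (hT.preconnected u w)
    induction hw with
    | refl => exact ⟨fun _ => .refl _, fun h => absurd hu h⟩
    | @tail x y _ hxy ih =>
      by_cases he : s(x, y) = s(u, v)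
      · rw [Sym2.eq_iff] at he
        rcases he with ⟨rfl, rfl⟩ | ⟨rfl, rfl⟩
        · exact ⟨fun h => absurd h hv, fun _ => .refl _⟩
        · exact ⟨fun _ => .refl _, fun h => absurd hu h⟩
      · have hadj : (T.deleteEdges {s(u, v)}).Adj x y := by
          rw [SimpleGraph.deleteEdges_adj]
          exact ⟨hxy, he⟩
        have hiff : x ∈ C ↔ y ∈ C := by
          by_contra hne
          by_cases hx : x ∈ C
          · have hy : y ∉ C := fun hy => hne (iff_of_true hx hy)
            obtain ⟨rfl, rfl⟩ := hC x y hxy hx hy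
            exact he rfl
          · have hy : y ∈ C := by by_contra hy; exact hne (iff_of_false hx hy)
            obtain ⟨rfl, rfl⟩ := hC y x hxy.symm hy hx
            exact he Sym2.eq_swap
        rw [← hiff]
        exact ⟨fun h => (ih.1 h).trans hadj.reachable, fun h => (ih.2 h).trans hadj.reachable⟩
  constructor
  · intro h
    rw [SimpleGraph.reachable_iff_reflTransGen] at h
    induction h with
    | refl => rfl
    | @tail x y _ hxy ih =>
      rw [SimpleGraph.deleteEdges_adj] at hxy
      obtain ⟨hxy, he⟩ := hxy
      rw [ih]
      constructor
      · intro hx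
        by_contra hy
        obtain ⟨rfl, rfl⟩ := hC x y hxy hx hy
        exact he rfl
      · intro hy
        by_contra hx
        obtain ⟨rfl, rfl⟩ := hC y x hxy.symm hy hx
        exact he Sym2.eq_swap
  · intro h
    by_cases ht : t ∈ C
    · exact ((key t).1 ht).symm.trans ((key t').1 (h.1 ht))
    · exact ((key t).2 ht).symm.trans ((key t').2 (fun h' => ht (h.2 h')))

theorem isTree_of_isEdgeCut (hT : T.Connected)
    (h : ∀ u v, T.Adj u v → ∃ C, IsEdgeCut T C u v ∨ IsEdgeCut T C v u) : T.IsTree := by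
  refine ⟨hT, SimpleGraph.isAcyclic_iff_forall_adj_isBridge.2 fun u v huv => ?_⟩
  rw [SimpleGraph.isBridge_iff]
  obtain ⟨C, hC | hC⟩ := h u v huv
  · rw [hC.reachable_iff hT]
    have := hC.1
    have := hC.2.1
    tauto
  · rw [Sym2.eq_swap, hC.reachable_iff hT]
    have := hC.1
    have := hC.2.1
    tauto

/-- A tree is a caterpillar as soon as every vertex is equal or adjacent to a vertex that is
incident with all edges of a cut between two fixed vertices. -/
theorem isCaterpillar_of_separating (hT : T.IsTree) (s t : N)
    (h : ∀ r, ∃ q, (r = q ∨ T.Adj r q) ∧ (q = s ∨ q = t ∨ ∃ C : Set N, s ∈ C ∧ t ∉ C ∧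
      ∀ x y, T.Adj x y → x ∈ C → y ∉ C → x = q ∨ y = q)) : IsCaterpillar T := by
  obtain ⟨p, hp⟩ := hT.connected.exists_isPath s t
  refine ⟨hT, s, t, p, hp, fun r => ?_⟩
  obtain ⟨q, hrq, hq⟩ := h r
  refine ⟨q, ?_, ?_⟩
  · rcases hq with rfl | rfl | ⟨C, hs, ht, hC⟩
    · exact p.start_mem_support
    · exact p.end_mem_support
    · obtain ⟨d, hd, h1, h2⟩ := p.exists_boundary_dart C hs ht
      rcases hC _ _ d.adj h1 h2 with h | h
      · rw [← h]; exact p.dart_fst_mem_support_of_mem_darts hd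
      · rw [← h]; exact p.dart_snd_mem_support_of_mem_darts hd
  · rcases hrq with rfl | h
    · simp
    · exact (SimpleGraph.dist_eq_one_iff_adj.2 h).le

theorem length_eq_one_of_isAcyclic (hT : T.IsAcyclic) {u v : N} (huv : T.Adj u v)
    {p : T.Walk u v} (hp : p.IsPath) : p.length = 1 := by
  have h1 : (SimpleGraph.Walk.cons huv .nil).IsPath := by
    simp [SimpleGraph.Walk.cons_isPath_iff, huv.ne]
  have := hT.subsingleton_path u v
  have := congrArg (fun q : T.Path u v => q.1.length)
    (Subsingleton.elim (⟨p, hp⟩ : T.Path u v) ⟨_, h1⟩)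
  simpa using this

theorem exists_isPath_getVert {s t : N} {p : T.Walk s t} (hp : p.IsPath) {i j : ℕ} (hij : i ≤ j)
    (hj : j ≤ p.length) : ∃ q : T.Walk (p.getVert i) (p.getVert j), q.IsPath ∧
      q.length = j - i ∧ ∀ r ∈ q.support, r ∈ p.support := by
  have h1 : (p.drop i).getVert (j - i) = p.getVert j := by
    rw [SimpleGraph.Walk.drop_getVert]; congr 1; omega
  rw [← h1]
  refine ⟨(p.drop i).take (j - i), (hp.drop i).take _, ?_, fun r hr => ?_⟩
  · rw [SimpleGraph.Walk.take_length, SimpleGraph.Walk.drop_length]; omega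
  · rw [SimpleGraph.Walk.support_take] at hr
    have hr := List.mem_of_mem_take hr
    rw [SimpleGraph.Walk.drop_support_eq_support_drop_min] at hr
    exact List.mem_of_mem_drop hr

end Trees

/-! ### Caterpillars of maximum degree three as parts of a comb. -/

section Comb

/-- The infinite comb: a one-way infinite path with one pendant vertex at every vertex. -/
def comb : SimpleGraph (ℕ × Bool) where
  Adj p q := (p.2 = false ∧ q.2 = false ∧ (p.1 + 1 = q.1 ∨ q.1 + 1 = p.1)) ∨
    (p.1 = q.1 ∧ p.2 ≠ q.2)
  symm := ⟨fun p q h => by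
    rcases h with ⟨h1, h2, h3⟩ | ⟨h1, h2⟩
    · exact Or.inl ⟨h2, h1, h3.symm⟩
    · exact Or.inr ⟨h1.symm, h2.symm⟩⟩
  loopless := ⟨fun p h => by
    rcases h with ⟨-, -, h⟩ | ⟨-, h⟩
    · omega
    · exact h rfl⟩

theorem comb_adj (p q : ℕ × Bool) : comb.Adj p q ↔
    (p.2 = false ∧ q.2 = false ∧ (p.1 + 1 = q.1 ∨ q.1 + 1 = p.1)) ∨ (p.1 = q.1 ∧ p.2 ≠ q.2) :=
  Iff.rfl

variable {N : Type u} {T : SimpleGraph N}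

/-- `φ` identifies `T` with the induced subgraph of the comb which consists of the spine from `0`
to `m` and some pendant vertices at inner vertices of this spine. -/
structure IsCombEmbedding (T : SimpleGraph N) (m : ℕ) (φ : N → ℕ × Bool) : Prop where
  injective : Function.Injective φ
  adj_iff : ∀ s t, T.Adj s t ↔ comb.Adj (φ s) (φ t)
  exists_spine : ∀ i ≤ m, ∃ t, φ t = (i, false)
  spine_le : ∀ t, (φ t).2 = false → (φ t).1 ≤ m
  pendant : ∀ t, (φ t).2 = true → 0 < (φ t).1 ∧ (φ t).1 < m

/-- The spine is a longest path dominating all vertices. Chords, double attachments and edges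
between vertices off the spine would give a path of length other than one between adjacent vertices,
against acyclicity. Maximality excludes pendants at the ends, and the degree bound allows one
pendant per inner vertex. -/
theorem exists_isCombEmbedding [Finite N] (hT : IsCaterpillar T) (hdeg : ∀ t, deg T t ≤ 3) :
    ∃ m φ, IsCombEmbedding T m φ := by
  classical
  have := Fintype.ofFinite N
  obtain ⟨hT, s₀, t₀, p₀, hp₀, hdom₀⟩ := hT
  let L : Set ℕ := {n | ∃ (s t : N) (p : T.Walk s t), p.IsPath ∧
    (∀ r, r ∈ p.support ∨ ∃ q ∈ p.support, T.Adj r q) ∧ p.length = n}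
  have hL : L.Nonempty := by
    refine ⟨_, s₀, t₀, p₀, hp₀, fun r => ?_, rfl⟩
    obtain ⟨q, hq, hrq⟩ := hdom₀ r
    rcases Nat.le_one_iff_eq_zero_or_eq_one.1 hrq with h | h
    · rw [(hT.connected.preconnected r q).dist_eq_zero_iff] at h
      exact Or.inl (h ▸ hq)
    · exact Or.inr ⟨q, hq, SimpleGraph.dist_eq_one_iff_adj.1 h⟩
  have hB : BddAbove L := by
    refine ⟨Fintype.card N, ?_⟩
    rintro n ⟨s, t, p, hp, -, rfl⟩
    exact hp.length_lt.le
  obtain ⟨s, t, p, hp, hdom, hlen⟩ := Nat.sSup_mem hL hB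
  have hmax : ∀ {s t : N} (q : T.Walk s t), q.IsPath →
      (∀ r, r ∈ q.support ∨ ∃ q' ∈ q.support, T.Adj r q') → q.length ≤ p.length :=
    fun q hq hd => hlen ▸ le_csSup hB ⟨_, _, q, hq, hd, rfl⟩
  have hinj : ∀ {i j}, i ≤ p.length → j ≤ p.length → p.getVert i = p.getVert j → i = j :=
    fun hi hj h => hp.getVert_injOn hi hj h
  have hspine : ∀ {i j}, i ≤ j → j ≤ p.length → T.Adj (p.getVert i) (p.getVert j) →
      i + 1 = j := by
    intro i j hij hj h
    obtain ⟨q, hq, hql, -⟩ := exists_isPath_getVert hp hij hj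
    have := length_eq_one_of_isAcyclic hT.isAcyclic h hq
    omega
  have hoff : ∀ {r i j}, r ∉ p.support → i < j → j ≤ p.length → T.Adj r (p.getVert i) →
      ¬ T.Adj r (p.getVert j) := by
    intro r i j hr hij hj h1 h2
    obtain ⟨q, hq, hql, hqs⟩ := exists_isPath_getVert hp hij.le hj
    have := length_eq_one_of_isAcyclic hT.isAcyclic h2
      (hq.cons (h := h1) (fun h => hr (hqs _ h)))
    rw [SimpleGraph.Walk.length_cons] at this
    omega
  have hoff' : ∀ {r r' i j}, r ∉ p.support → r' ∉ p.support → i ≤ j → j ≤ p.length →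
      T.Adj r (p.getVert i) → T.Adj r' (p.getVert j) → ¬ T.Adj r r' := by
    intro r r' i j hr hr' hij hj h1 h2 h
    obtain ⟨q, hq, hql, hqs⟩ := exists_isPath_getVert hp hij hj
    have := length_eq_one_of_isAcyclic hT.isAcyclic h
      ((hq.cons (h := h1) (fun h => hr (hqs _ h))).concat (by
        rw [SimpleGraph.Walk.support_cons, List.mem_cons]
        rintro (rfl | h')
        · exact h.ne rfl
        · exact hr' (hqs _ h')) h2.symm)
    rw [SimpleGraph.Walk.length_concat, SimpleGraph.Walk.length_cons] at this
    omega
  have hpos : ∀ {r i}, r ∉ p.support → T.Adj r (p.getVert i) → 0 < i := by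
    intro r i hr h
    by_contra hi
    obtain rfl : i = 0 := by omega
    rw [SimpleGraph.Walk.getVert_zero] at h
    have := hmax (.cons h p) (hp.cons hr) fun r' => by
      rcases hdom r' with h | ⟨q, hq, h⟩
      · exact Or.inl (by simp [h])
      · exact Or.inr ⟨q, by simp [hq], h⟩
    rw [SimpleGraph.Walk.length_cons] at this
    omega
  have hlt : ∀ {r i}, r ∉ p.support → i ≤ p.length → T.Adj r (p.getVert i) → i < p.length := by
    intro r i hr hi h
    by_contra hi'
    obtain rfl : i = p.length := by omega
    rw [SimpleGraph.Walk.getVert_length] at h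
    have := hmax (p.concat h.symm) (hp.concat hr _) fun r' => by
      rw [SimpleGraph.Walk.support_concat]
      rcases hdom r' with h | ⟨q, hq, h⟩
      · exact Or.inl (by simp [h])
      · exact Or.inr ⟨q, by simp [hq], h⟩
    rw [SimpleGraph.Walk.length_concat] at this
    omega
  have huniq : ∀ {r r' i}, r ∉ p.support → r' ∉ p.support → i ≤ p.length →
      T.Adj r (p.getVert i) → T.Adj r' (p.getVert i) → r = r' := by
    intro r r' i hr hr' hi h h'
    by_contra hne
    obtain ⟨k, rfl⟩ := Nat.exists_eq_add_of_lt (hpos hr h)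
    rw [zero_add] at *
    have hk := hlt hr hi h
    -- Two neighbours on the path and two pendants would make the degree at least four.
    have hsub : ({p.getVert k, p.getVert (k + 1 + 1), r, r'} : Set N) ⊆
        T.neighborSet (p.getVert (k + 1)) := by
      intro w hw
      simp only [Set.mem_insert_iff, Set.mem_singleton_iff] at hw
      rcases hw with rfl | rfl | rfl | rfl
      · exact (p.adj_getVert_succ (by omega)).symm
      · exact p.adj_getVert_succ hk
      · exact h.symm
      · exact h'.symm
    have hmem : ∀ {i x}, x ∉ p.support → p.getVert i ≠ x :=
      fun hx e => hx (e ▸ p.getVert_mem_support _)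
    have h1 : p.getVert k ≠ p.getVert (k + 1 + 1) := fun e => by
      have := hinj (by omega) (by omega) e
      omega
    have hcard := Set.ncard_le_ncard hsub (Set.toFinite _)
    rw [Set.ncard_insert_of_notMem, Set.ncard_insert_of_notMem, Set.ncard_pair hne] at hcard
    · have := hdeg (p.getVert (k + 1))
      unfold deg at this
      omega
    · simp [hmem hr, hmem hr']
    · simp [hmem hr, hmem hr', h1]
  have hex : ∀ r, ∃ c : ℕ × Bool, c.1 ≤ p.length ∧ ((c.2 = false ∧ r = p.getVert c.1) ∨
      (c.2 = true ∧ r ∉ p.support ∧ T.Adj r (p.getVert c.1))) := by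
    intro r
    by_cases hr : r ∈ p.support
    · obtain ⟨i, rfl, hi⟩ := SimpleGraph.Walk.mem_support_iff_exists_getVert.1 hr
      exact ⟨(i, false), hi, Or.inl ⟨rfl, rfl⟩⟩
    · obtain ⟨q, hq, h⟩ := (hdom r).resolve_left hr
      obtain ⟨i, rfl, hi⟩ := SimpleGraph.Walk.mem_support_iff_exists_getVert.1 hq
      exact ⟨(i, true), hi, Or.inr ⟨rfl, hr, h⟩⟩
  choose φ hφ1 hφ2 using hex
  refine ⟨p.length, φ, fun x y hxy => ?_, fun x y => ?_, fun i hi => ?_, fun x _ => hφ1 x,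
    fun x hx => ?_⟩
  · rcases hφ2 x with ⟨h1, h2⟩ | ⟨h1, h2, h3⟩ <;> rcases hφ2 y with ⟨k1, k2⟩ | ⟨k1, k2, k3⟩
    · rw [h2, k2, hxy]
    · rw [hxy, k1] at h1; cases h1
    · rw [hxy, k1] at h1; cases h1
    · exact huniq h2 k2 (hφ1 x) h3 (hxy ▸ k3)
  · rw [comb_adj]
    rcases hφ2 x with ⟨h1, h2⟩ | ⟨h1, h2, h3⟩ <;> rcases hφ2 y with ⟨k1, k2⟩ | ⟨k1, k2, k3⟩
    · simp only [h1, k1, true_and, ne_eq, not_true, and_false, or_false]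
      conv_lhs => rw [h2, k2]
      constructor
      · intro h
        rcases le_total (φ x).1 (φ y).1 with hle | hle
        · exact Or.inl (hspine hle (hφ1 y) h)
        · exact Or.inr (hspine hle (hφ1 x) h.symm)
      · have := hφ1 x
        have := hφ1 y
        rintro (h | h)
        · rw [← h]; exact p.adj_getVert_succ (by omega)
        · rw [← h]; exact (p.adj_getVert_succ (by omega)).symm
    · simp only [h1, k1]
      simp only [Bool.true_eq_false, false_and, and_false, false_or, ne_eq, Bool.false_eq_true,
        not_false_iff, and_true]
      constructor
      · intro h
        rw [h2] at h
        rcases lt_trichotomy (φ x).1 (φ y).1 with hle | hle | hle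
        · exact absurd k3 (hoff k2 hle (hφ1 y) h.symm)
        · exact hle
        · exact absurd h.symm (hoff k2 hle (hφ1 x) k3)
      · intro h
        rw [h2, h]; exact k3.symm
    · simp only [h1, k1]
      simp only [Bool.true_eq_false, false_and, false_or, ne_eq,
        not_false_iff, and_true]
      constructor
      · intro h
        rw [k2] at h
        rcases lt_trichotomy (φ x).1 (φ y).1 with hle | hle | hle
        · exact absurd h (hoff h2 hle (hφ1 y) h3)
        · exact hle
        · exact absurd h3 (hoff h2 hle (hφ1 x) h)
      · intro h
        rw [k2, ← h]; exact h3
    · simp only [h1, k1]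
      simp only [Bool.true_eq_false, false_and, false_or, ne_eq, not_true, and_false, iff_false]
      intro h
      rcases le_total (φ x).1 (φ y).1 with hle | hle
      · exact hoff' h2 k2 hle (hφ1 y) h3 k3 h
      · exact hoff' k2 h2 hle (hφ1 x) k3 h3 h.symm
  · refine ⟨p.getVert i, ?_⟩
    rcases hφ2 (p.getVert i) with ⟨h1, h2⟩ | ⟨h1, h2, h3⟩
    · exact Prod.ext (hinj hi (hφ1 _) h2).symm h1
    · exact absurd (p.getVert_mem_support i) h2
  · rcases hφ2 x with ⟨h1, h2⟩ | ⟨h1, h2, h3⟩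
    · rw [h1] at hx; cases hx
    · exact ⟨hpos h2 h3, hlt h2 (hφ1 x) h3⟩

end Comb

/-! ### Branches at a spine vertex, and properties of embedded combs. -/

section CombEmbedding

variable {N : Type u} {T : SimpleGraph N} {m : ℕ} {φ : N → ℕ × Bool}

/-- The branch of the comb at the spine vertex `(i, false)` in which a vertex lies: `0` on the
left, `1` for the pendant vertex, `2` on the right, and `3` for `(i, false)` itself. -/
def branch (i : ℕ) (p : ℕ × Bool) : ℕ :=
  if p.1 < i then 0 else if i < p.1 then 2 else if p.2 then 1 else 3

theorem branch_eq_zero {i : ℕ} {p : ℕ × Bool} : branch i p = 0 ↔ p.1 < i := by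
  unfold branch; split_ifs <;> simp_all

theorem branch_eq_one {i : ℕ} {p : ℕ × Bool} : branch i p = 1 ↔ p = (i, true) := by
  obtain ⟨j, b⟩ := p
  unfold branch
  split_ifs <;> simp_all <;> omega

theorem branch_eq_two {i : ℕ} {p : ℕ × Bool} : branch i p = 2 ↔ i < p.1 := by
  unfold branch; split_ifs <;> simp_all; omega

theorem branch_eq_three {i : ℕ} {p : ℕ × Bool} : branch i p = 3 ↔ p = (i, false) := by
  obtain ⟨j, b⟩ := p
  unfold branch
  split_ifs <;> simp_all <;> omega

theorem branch_le (i : ℕ) (p : ℕ × Bool) : branch i p ≤ 3 := by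
  unfold branch; split_ifs <;> omega

/-- Two adjacent vertices of the comb in different branches are joined by an edge at the center. -/
theorem comb_adj_branch {i : ℕ} {p q r : ℕ × Bool} (hr : comb.Adj (i, false) r)
    (hpq : comb.Adj p q) (hp : branch i p ≠ branch i r) (hq : branch i q = branch i r) :
    p = (i, false) ∧ q = r := by
  obtain ⟨a, b⟩ := p
  obtain ⟨c, d⟩ := q
  obtain ⟨e, f⟩ := r
  simp only [comb_adj, true_and] at hr hpq
  simp only [Prod.mk.injEq]
  unfold branch at *
  cases b <;> cases d <;> cases f <;>
    simp only [Bool.false_eq_true, Bool.true_eq_false, if_true, if_false, true_and,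
      and_true, false_and, and_false, ne_eq, not_true, not_false_iff, false_or, or_false] at * <;>
    split_ifs at * <;> omega

namespace IsCombEmbedding

theorem connected (h : IsCombEmbedding T m φ) : T.Connected := by
  obtain ⟨s, hs⟩ := h.exists_spine 0 (Nat.zero_le m)
  have hsp : ∀ i ≤ m, ∀ t, φ t = (i, false) → T.Reachable s t := by
    intro i
    induction i with
    | zero =>
      intro _ t ht
      rw [h.injective (hs.trans ht.symm)]
    | succ i ih =>
      intro hi t ht
      obtain ⟨r, hr⟩ := h.exists_spine i (by omega)
      refine (ih (by omega) r hr).trans (SimpleGraph.Adj.reachable ?_)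
      rw [h.adj_iff, hr, ht, comb_adj]
      simp
  have hall : ∀ t, T.Reachable s t := by
    intro t
    cases hb : (φ t).2 with
    | false => exact hsp _ (h.spine_le t hb) t (Prod.ext rfl hb)
    | true =>
      obtain ⟨r, hr⟩ := h.exists_spine (φ t).1 (h.pendant t hb).2.le
      refine (hsp _ (h.pendant t hb).2.le r hr).trans (SimpleGraph.Adj.reachable ?_)
      rw [h.adj_iff, hr, comb_adj]
      simp [hb]
  have : Nonempty N := ⟨s⟩
  exact ⟨fun a b => (hall a).symm.trans (hall b)⟩

theorem isEdgeCut (h : IsCombEmbedding T m φ) {i : ℕ} {v w : N} (hv : φ v = (i, false))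
    (hvw : T.Adj v w) : IsEdgeCut T {t | branch i (φ t) ≠ branch i (φ w)} v w := by
  refine ⟨?_, fun hw => hw rfl, fun x y hxy hx hy => ?_⟩
  · rw [Set.mem_ofPred_eq, hv, branch_eq_three.2 rfl]
    intro e
    exact hvw.ne (h.injective (hv.trans (branch_eq_three.1 e.symm).symm))
  · rw [h.adj_iff, hv] at hvw
    obtain ⟨h1, h2⟩ := comb_adj_branch hvw ((h.adj_iff _ _).1 hxy) hx (not_not.1 hy)
    exact ⟨h.injective (h1.trans hv.symm), h.injective h2⟩

/-- This reduces all later questions about sides, heads and tails of tree edges to comparing branch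
numbers. -/
theorem reachable_iff (h : IsCombEmbedding T m φ) {i : ℕ} {v w : N} (hv : φ v = (i, false))
    (hvw : T.Adj v w) (t t' : N) : (T.deleteEdges {s(v, w)}).Reachable t t' ↔
      (branch i (φ t) = branch i (φ w) ↔ branch i (φ t') = branch i (φ w)) := by
  rw [(h.isEdgeCut hv hvw).reachable_iff h.connected]
  simp only [Set.mem_ofPred_eq]
  tauto

theorem isTree (h : IsCombEmbedding T m φ) : T.IsTree := by
  refine isTree_of_isEdgeCut h.connected fun u v huv => ?_
  cases hu : (φ u).2 with
  | false => exact ⟨_, Or.inl (h.isEdgeCut (Prod.ext rfl hu) huv)⟩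
  | true =>
    refine ⟨_, Or.inr (h.isEdgeCut (i := (φ v).1) (Prod.ext rfl ?_) huv.symm)⟩
    rw [h.adj_iff, comb_adj, hu] at huv
    simp at huv
    exact huv.2

theorem isCaterpillar (h : IsCombEmbedding T m φ) : IsCaterpillar T := by
  obtain ⟨s, hs⟩ := h.exists_spine 0 (Nat.zero_le m)
  obtain ⟨t, ht⟩ := h.exists_spine m le_rfl
  have key : ∀ q, (φ q).2 = false → q = s ∨ q = t ∨ ∃ C : Set N, s ∈ C ∧ t ∉ C ∧
      ∀ x y, T.Adj x y → x ∈ C → y ∉ C → x = q ∨ y = q := by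
    intro q hq
    by_cases h0 : (φ q).1 = 0
    · exact Or.inl (h.injective (hs ▸ Prod.ext h0 hq))
    refine Or.inr (Or.inr ⟨{r | (φ r).1 < (φ q).1}, ?_, ?_, fun x y hxy hx hy => Or.inr ?_⟩)
    · rw [Set.mem_ofPred_eq, hs]; simp only; omega
    · rw [Set.mem_ofPred_eq, ht]; simpa using h.spine_le q hq
    · rw [h.adj_iff, comb_adj] at hxy
      rw [Set.mem_ofPred_eq] at hx hy
      rcases hxy with ⟨-, h2, h3⟩ | ⟨h1, -⟩
      · exact h.injective (Prod.ext (by omega) (h2.trans hq.symm))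
      · omega
  refine isCaterpillar_of_separating h.isTree s t fun r => ?_
  cases hr : (φ r).2 with
  | false => exact ⟨r, Or.inl rfl, key r hr⟩
  | true =>
    obtain ⟨q, hq⟩ := h.exists_spine (φ r).1 (h.pendant r hr).2.le
    refine ⟨q, Or.inr ?_, key q (by rw [hq])⟩
    rw [h.adj_iff, hq, comb_adj]
    simp [hr]

theorem isBipartite (h : IsCombEmbedding T m φ) : T.IsBipartite := by
  refine isBipartite_iff_exists_coloring.2
    ⟨fun t => ((φ t).1 + (φ t).2.toNat) % 2 = 0, fun x y hxy => ?_⟩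
  rw [h.adj_iff, comb_adj] at hxy
  dsimp only
  generalize φ x = p at *
  generalize φ y = q at *
  revert hxy
  obtain ⟨a, b⟩ := p
  obtain ⟨c, d⟩ := q
  cases b <;> cases d <;> simp <;> omega

/-- With each pendant placed right after its spine vertex, all edges leaving an initial segment have
the same end inside it, so only one row is nonzero. -/
theorem isThin (h : IsCombEmbedding T m φ) :
    IsThin T (fun t => 2 * (φ t).1 + (φ t).2.toNat) := by
  constructor
  · intro x y hxy
    apply h.injective
    dsimp only at hxy
    revert hxy
    generalize φ x = p
    generalize φ y = q
    obtain ⟨a, b⟩ := p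
    obtain ⟨c, d⟩ := q
    cases b <;> cases d <;> simp <;> omega
  · intro k a ha a' ha' b hb b' hb' h1 h2
    rw [h.adj_iff, comb_adj] at *
    simp only [Set.mem_ofPred_eq] at *
    generalize φ a = p at *
    generalize φ a' = p' at *
    generalize φ b = q at *
    generalize φ b' = q' at *
    obtain ⟨p, c⟩ := p
    obtain ⟨p', c'⟩ := p'
    obtain ⟨q, d⟩ := q
    obtain ⟨q', d'⟩ := q'
    cases c <;> cases c' <;> cases d <;> cases d' <;> simp at * <;> omega

theorem deg_eq_three (h : IsCombEmbedding T m φ)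
    (hfull : ∀ i, 0 < i → i < m → ∃ t, φ t = (i, true)) {v : N} {i : ℕ} (hv : φ v = (i, false))
    (h0 : 0 < i) (hm : i < m) : deg T v = 3 := by
  obtain ⟨a, ha⟩ := h.exists_spine (i - 1) (by omega)
  obtain ⟨b, hb⟩ := h.exists_spine (i + 1) (by omega)
  obtain ⟨c, hc⟩ := hfull i h0 hm
  rw [deg, Set.ncard_eq_three]
  refine ⟨a, b, c, ?_, ?_, ?_, ?_⟩
  · rintro rfl; rw [ha, Prod.mk.injEq] at hb; omega
  · rintro rfl; rw [ha, Prod.mk.injEq] at hc; omega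
  · rintro rfl; rw [hb, Prod.mk.injEq] at hc; omega
  · ext t
    simp only [SimpleGraph.mem_neighborSet, Set.mem_insert_iff, Set.mem_singleton_iff]
    rw [h.adj_iff, comb_adj, ← h.injective.eq_iff (a := t), ← h.injective.eq_iff (a := t),
      ← h.injective.eq_iff (a := t), ha, hb, hc, hv]
    obtain ⟨j, b⟩ := φ t
    cases b <;> simp <;> omega

theorem isLeaf_of_spine_end (h : IsCombEmbedding T m φ) (hm : 1 ≤ m) {v : N}
    (hv : φ v = (0, false) ∨ φ v = (m, false)) : IsLeaf T v := by
  have key : ∃ j, j ≤ m ∧ ∀ p : ℕ × Bool, (p.2 = false → p.1 ≤ m) →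
      (p.2 = true → 0 < p.1 ∧ p.1 < m) → (comb.Adj (φ v) p ↔ p = (j, false)) := by
    rcases hv with hv | hv
    · refine ⟨1, hm, fun p h1 h2 => ?_⟩
      rw [hv, comb_adj]
      obtain ⟨j, b⟩ := p
      cases b <;> simp at * <;> omega
    · refine ⟨m - 1, by omega, fun p h1 h2 => ?_⟩
      rw [hv, comb_adj]
      obtain ⟨j, b⟩ := p
      cases b <;> simp at * <;> omega
  obtain ⟨j, hj, hadj⟩ := key
  obtain ⟨w, hw⟩ := h.exists_spine j hj
  rw [IsLeaf, deg, Set.ncard_eq_one]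
  refine ⟨w, ?_⟩
  ext t
  rw [SimpleGraph.mem_neighborSet, Set.mem_singleton_iff, h.adj_iff,
    hadj _ (h.spine_le t) (h.pendant t), ← hw, h.injective.eq_iff]

theorem isLeaf_of_pendant (h : IsCombEmbedding T m φ) {v : N} (hv : (φ v).2 = true) :
    IsLeaf T v := by
  obtain ⟨w, hw⟩ := h.exists_spine (φ v).1 (h.pendant v hv).2.le
  rw [IsLeaf, deg, Set.ncard_eq_one]
  refine ⟨w, ?_⟩
  ext t
  rw [SimpleGraph.mem_neighborSet, Set.mem_singleton_iff, h.adj_iff, ← h.injective.eq_iff,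
    hw, comb_adj, hv]
  obtain ⟨j, b⟩ := φ t
  cases b <;> simp <;> omega

theorem isLeaf_iff (h : IsCombEmbedding T m φ) (hm : 1 ≤ m)
    (hfull : ∀ i, 0 < i → i < m → ∃ t, φ t = (i, true)) (v : N) :
    IsLeaf T v ↔ ¬ ((φ v).2 = false ∧ 0 < (φ v).1 ∧ (φ v).1 < m) := by
  constructor
  · rintro hl ⟨h1, h2, h3⟩
    have := h.deg_eq_three hfull (v := v) (Prod.ext rfl h1) h2 h3
    rw [IsLeaf] at hl
    omega
  · intro hn
    cases hv : (φ v).2 with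
    | true => exact h.isLeaf_of_pendant hv
    | false =>
      have := h.spine_le v hv
      refine h.isLeaf_of_spine_end hm ?_
      by_cases h0 : (φ v).1 = 0
      · exact Or.inl (Prod.ext h0 hv)
      · refine Or.inr (Prod.ext (?_ : (φ v).1 = m) hv)
        by_contra hne
        exact hn ⟨hv, by omega, by omega⟩

theorem one_le (h : IsCombEmbedding T m φ) [Nontrivial N] : 1 ≤ m := by
  by_contra hm
  obtain ⟨x, y, hxy⟩ := exists_pair_ne N
  have : ∀ t, φ t = (0, false) := by
    intro t
    cases ht : (φ t).2 with
    | false => exact Prod.ext (by have := h.spine_le t ht; simp only; omega) ht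
    | true => have := h.pendant t ht; omega
  exact hxy (h.injective ((this x).trans (this y).symm))

/-- An inner spine vertex without a pendant would have degree two. -/
theorem full_of_isSubcubicTree (h : IsCombEmbedding T m φ) (hT : IsSubcubicTree T) :
    ∀ i, 0 < i → i < m → ∃ t, φ t = (i, true) := by
  intro i h0 hm
  by_contra hno
  obtain ⟨v, hv⟩ := h.exists_spine i hm.le
  obtain ⟨a, ha⟩ := h.exists_spine (i - 1) (by omega)
  obtain ⟨b, hb⟩ := h.exists_spine (i + 1) (by omega)
  have hd : deg T v = 2 := by
    rw [deg, Set.ncard_eq_two]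
    refine ⟨a, b, ?_, ?_⟩
    · rintro rfl; rw [ha, Prod.mk.injEq] at hb; omega
    · ext t
      have ht : φ t ≠ (i, true) := fun e => hno ⟨t, e⟩
      simp only [SimpleGraph.mem_neighborSet, Set.mem_insert_iff, Set.mem_singleton_iff]
      rw [h.adj_iff, comb_adj, ← h.injective.eq_iff (a := t), ← h.injective.eq_iff (a := t),
        ha, hb, hv]
      revert ht
      obtain ⟨j, b⟩ := φ t
      cases b <;> simp <;> omega
  have := hT.2.2 v (by rw [IsLeaf]; omega)
  omega

end IsCombEmbedding

theorem isPivotMinorOfPath_of_isCaterpillar [Finite N] (hT : IsCaterpillar T)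
    (hdeg : ∀ t, deg T t ≤ 3) : IsPivotMinorOfPath T := by
  obtain ⟨m, φ, h⟩ := exists_isCombEmbedding hT hdeg
  exact h.isThin.isPivotMinorOfPath h.isBipartite

end CombEmbedding

/-! ### Rank at most one in combinatorial form. -/

section Rank

variable {V : Type u}

/-- In one direction all columns are multiples of one vector. In the other, for any edge `a₀b₀`
across the cut, the matrix is the outer product of the column of `b₀` and the row of `a₀`. -/
theorem cutRank_le_one_iff [Fintype V] (G : SimpleGraph V) (X : Set V) :
    cutRank G X ≤ 1 ↔ CutLeOne G X := by
  classical
  have hentry : ∀ a b, (G.adjMatrix (ZMod 2)) a b ≠ 0 ↔ G.Adj a b := fun a b => by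
    rw [SimpleGraph.adjMatrix_apply]; simp
  unfold cutRank
  constructor
  · intro h
    rw [Matrix.rank, finrank_le_one_iff] at h
    obtain ⟨v, hv⟩ := h
    have hcol : ∀ b : {b // b ∉ X}, ∃ c : ZMod 2, ∀ a : {a // a ∈ X},
        c * v.1 a = G.adjMatrix (ZMod 2) a b := by
      intro b
      obtain ⟨c, hc⟩ := hv ⟨_, Pi.single b 1, rfl⟩
      refine ⟨c, fun a => ?_⟩
      have := congrFun (congrArg Subtype.val hc) a
      simpa using this
    intro a ha a' ha' b hb b' hb' h1 h2
    obtain ⟨c, hc⟩ := hcol ⟨b, hb⟩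
    obtain ⟨c', hc'⟩ := hcol ⟨b', hb'⟩
    rw [← hentry, ← hc' ⟨a', ha'⟩] at h2
    rw [← hentry, ← hc ⟨a, ha⟩] at h1
    rw [← hentry, ← hc' ⟨a, ha⟩]
    exact mul_ne_zero (left_ne_zero_of_mul h2) (right_ne_zero_of_mul h1)
  · intro h
    by_cases hz : ∃ a ∈ X, ∃ b, b ∉ X ∧ G.Adj a b
    · obtain ⟨a₀, ha₀, b₀, hb₀, h₀⟩ := hz
      refine le_trans (le_of_eq ?_) (Matrix.rank_vecMulVec_le
        (fun a : {a // a ∈ X} => G.adjMatrix (ZMod 2) a b₀)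
        (fun b : {b // b ∉ X} => G.adjMatrix (ZMod 2) a₀ b))
      congr 1
      ext a b
      have h1 := h a.2 ha₀ b.2 hb₀
      have h2 := h ha₀ a.2 b.2 hb₀
      have h3 := h a.2 ha₀ hb₀ b.2
      have h4 := h ha₀ a.2 hb₀ b.2
      simp only [Matrix.submatrix_apply, SimpleGraph.adjMatrix_apply, Matrix.vecMulVec_apply]
      by_cases p : G.Adj a b <;> by_cases q : G.Adj a b₀ <;> by_cases r : G.Adj a₀ b <;>
        simp_all
    · refine le_trans (le_of_eq ?_) zero_le_one
      rw [← Matrix.rank_zero (m := {a // a ∈ X}) (n := {b // b ∉ X}) (R := ZMod 2)]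
      congr 1
      ext a b
      simp only [Matrix.submatrix_apply, SimpleGraph.adjMatrix_apply, Matrix.zero_apply,
        ite_eq_right_iff]
      exact fun hab => absurd ⟨a, a.2, b, b.2, hab⟩ hz

end Rank

/-! ### Linear rank-decompositions and thin orderings. -/

namespace RankDecomposition

variable {V : Type u}

theorem finite_dart (D : RankDecomposition V) : Finite D.T.Dart := by
  have := D.finite_node
  exact Finite.of_injective _ (SimpleGraph.Dart.toProd_injective (G := D.T))

theorem width_le_one_iff [Fintype V] (D : RankDecomposition V) (G : SimpleGraph V) :
    D.width G ≤ 1 ↔ ∀ v w, D.T.Adj v w → CutLeOne G (D.side s(v, w) v) := by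
  have := D.finite_dart
  constructor
  · intro h v w hvw
    rw [← cutRank_le_one_iff]
    exact (le_ciSup (f := fun d => D.edgeWidth G d) (Set.finite_range _).bddAbove
      ⟨(v, w), hvw⟩).trans h
  · intro h
    refine ciSup_le' fun d => ?_
    exact (cutRank_le_one_iff _ _).2 (h _ _ d.adj)

theorem deg_le_three (D : RankDecomposition V) (t : D.Node) : deg D.T t ≤ 3 := by
  by_cases h : IsLeaf D.T t
  · rw [IsLeaf] at h; omega
  · exact (D.subcubic.2.2 t h).le

variable {D : RankDecomposition V} {m : ℕ} {φ : D.Node → ℕ × Bool}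

theorem side_eq (h : IsCombEmbedding D.T m φ) {i : ℕ} {v w : D.Node} (hv : φ v = (i, false))
    (hvw : D.T.Adj v w) (s : D.Node) : D.side s(v, w) s =
      {a | branch i (φ s) = branch i (φ w) ↔ branch i (φ (D.L a)) = branch i (φ w)} := by
  ext a
  exact h.reachable_iff hv hvw s _

theorem side_center (h : IsCombEmbedding D.T m φ) {i : ℕ} {v w : D.Node}
    (hv : φ v = (i, false)) (hvw : D.T.Adj v w) : D.side s(v, w) v =
      {a | branch i (φ (D.L a)) ≠ branch i (φ w)} := by
  rw [side_eq h hv hvw]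
  have : branch i (φ v) ≠ branch i (φ w) := (h.isEdgeCut hv hvw).1
  ext a
  simp [this]

theorem side_branch (h : IsCombEmbedding D.T m φ) {i : ℕ} {v w : D.Node}
    (hv : φ v = (i, false)) (hvw : D.T.Adj v w) : D.side s(w, v) w =
      {a | branch i (φ (D.L a)) ≠ branch i (φ w)}ᶜ := by
  rw [Sym2.eq_swap, side_eq h hv hvw]
  ext a
  simp

/-- The leaves are the pendants and the two spine ends, exactly one per spine index, so that index
orders the vertices. For `1 ≤ k ≤ m` the initial segment is a side of the spine edge from `k - 1` to
`k`; the other segments are empty or everything. -/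
theorem isThin_of_width_le_one [Fintype V] {G : SimpleGraph V} (h : IsCombEmbedding D.T m φ)
    (hw : D.width G ≤ 1) : IsThin G (fun a => (φ (D.L a)).1) := by
  rw [width_le_one_iff] at hw
  have hfull := h.full_of_isSubcubicTree D.subcubic
  have := D.subcubic.2.1
  have hleaf := fun a => (h.isLeaf_iff h.one_le hfull (D.L a)).1 (D.L a).2
  have hle : ∀ a, (φ (D.L a)).1 ≤ m := by
    intro a
    cases hb : (φ (D.L a)).2 with
    | false => exact h.spine_le _ hb
    | true => exact (h.pendant _ hb).2.le
  constructor
  · intro a b hab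
    dsimp only at hab
    apply D.L.injective
    apply Subtype.ext
    apply h.injective
    refine Prod.ext hab ?_
    have ha := hleaf a
    have hb := hleaf b
    have hpa := h.pendant (D.L a)
    have hpb := h.pendant (D.L b)
    rw [← hab] at hb hpb
    clear hleaf hle hw hfull
    cases h1 : (φ (D.L a)).2 <;> cases h2 : (φ (D.L b)).2 <;> simp [h1, h2] at * <;> omega
  · intro k
    by_cases h0 : k = 0
    · subst h0
      intro a ha
      simp at ha
    by_cases hk : m < k
    · intro a _ a' _ b hb
      exact absurd ((hle b).trans_lt hk) hb
    obtain ⟨i, rfl⟩ := Nat.exists_eq_succ_of_ne_zero h0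
    obtain ⟨v, hv⟩ := h.exists_spine i (by omega)
    obtain ⟨w, hvw⟩ := h.exists_spine (i + 1) (by omega)
    have hadj : D.T.Adj v w := by
      rw [h.adj_iff, hv, hvw, comb_adj]; simp
    have := hw v w hadj
    rw [side_center h hv hadj, (branch_eq_two (p := φ w)).2 (by rw [hvw]; simp)] at this
    convert this using 1
    ext a
    simp only [Set.mem_ofPred_eq, ne_eq, branch_eq_two]
    omega

/-- The nodes of the caterpillar with spine from `0` to `m` and all inner pendant vertices. -/
abbrev CombNode (m : ℕ) : Type :=
  {p : ℕ × Bool // (p.2 = false → p.1 ≤ m) ∧ (p.2 = true → 0 < p.1 ∧ p.1 < m)}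

theorem finite_combNode (m : ℕ) : Finite (CombNode m) := by
  refine Finite.of_injective (β := Fin (m + 1) × Bool)
    (fun p => (⟨p.1.1, ?_⟩, p.1.2)) fun p q h => ?_
  · have := p.2
    cases hb : p.1.2 <;> simp [hb] at this <;> omega
  · rw [Prod.mk.injEq, Fin.mk.injEq] at h
    exact Subtype.ext (Prod.ext h.1 h.2)

theorem isCombEmbedding_combNode (m : ℕ) :
    IsCombEmbedding (comb.comap (Subtype.val : CombNode m → ℕ × Bool)) m Subtype.val where
  injective := Subtype.val_injective
  adj_iff _ _ := Iff.rfl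
  exists_spine i hi := ⟨⟨(i, false), by simpa using hi⟩, rfl⟩
  spine_le t := t.2.1
  pendant t := t.2.2

theorem full_combNode (m i : ℕ) (h0 : 0 < i) (hm : i < m) :
    ∃ t : CombNode m, t.val = (i, true) := ⟨⟨(i, true), by simp [h0, hm]⟩, rfl⟩

/-- The vertices are hung on the full comb in the order `σ`. The decomposition does not depend on
`G`, so this also shows that linear rank-decompositions exist at all. -/
theorem exists_isLinear {m : ℕ} (hm : 1 ≤ m) (σ : V ≃ Fin (m + 1)) :
    ∃ D : RankDecomposition V, D.IsLinear ∧ ∀ G : SimpleGraph V,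
      (∀ k, CutLeOne G {a | (σ a : ℕ) < k}) →
        ∀ v w, D.T.Adj v w → CutLeOne G (D.side s(v, w) v) := by
  have h := isCombEmbedding_combNode m
  have hleaf := h.isLeaf_iff hm (full_combNode m)
  let leaf : Fin (m + 1) → CombNode m := fun i => ⟨(i, decide (0 < (i : ℕ) ∧ (i : ℕ) < m)), by
    have := i.2
    simp; omega⟩
  have hL : ∀ i, IsLeaf (comb.comap (Subtype.val : CombNode m → ℕ × Bool)) (leaf i) := by
    intro i
    rw [hleaf]
    simp [leaf]
  have hbij : Function.Bijective fun a => (⟨leaf (σ a), hL _⟩ :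
      {t // IsLeaf (comb.comap (Subtype.val : CombNode m → ℕ × Bool)) t}) := by
    constructor
    · intro a b hab
      have := congrArg (fun t => t.1.1.1) hab
      exact σ.injective (Fin.ext this)
    · rintro ⟨t, ht⟩
      have hlt : t.1.1 < m + 1 := by
        have := t.2
        cases hb : t.1.2 <;> simp [hb] at this <;> omega
      refine ⟨σ.symm ⟨t.1.1, hlt⟩, Subtype.ext (Subtype.ext (Prod.ext ?_ ?_))⟩
      · simp [leaf]
      · rw [hleaf] at ht
        have := t.2.2
        cases hb : t.1.2 <;> simp [leaf, hb] at * <;> omega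
  let D : RankDecomposition V :=
    { Node := CombNode m
      finite_node := finite_combNode m
      T := comb.comap Subtype.val
      subcubic := by
        refine ⟨h.isTree, ⟨⟨(0, false), by simp⟩, ⟨(m, false), by simp⟩, fun e => ?_⟩,
          fun t ht => ?_⟩
        · have := congrArg (fun t => t.1.1) e
          simp only at this
          omega
        · rw [hleaf, not_not] at ht
          exact h.deg_eq_three (full_combNode m) (Prod.ext rfl ht.1) ht.2.1 ht.2.2
      L := Equiv.ofBijective _ hbij }
  have hD : IsCombEmbedding D.T m Subtype.val := h
  have hσ : ∀ a, (D.L a).1.1.1 = σ a := fun a => rfl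
  refine ⟨D, h.isCaterpillar, fun G hG => ?_⟩
  have key : ∀ (i : ℕ) (v w : D.Node), v.1 = (i, false) → D.T.Adj v w →
      CutLeOne G {a | branch i (D.L a).1.1 ≠ branch i w.1} := by
    intro i v w hv hvw
    rw [hD.adj_iff, hv, comb_adj] at hvw
    rcases hvw with ⟨-, h2, h3 | h3⟩ | ⟨h2, h3⟩
    · rw [(branch_eq_two (i := i) (p := w.1)).2 (by simp only at h3; omega)]
      convert hG (i + 1) using 1
      ext a
      simp only [Set.mem_ofPred_eq, ne_eq, branch_eq_two, hσ]
      omega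
    · rw [(branch_eq_zero (i := i) (p := w.1)).2 (by simp only at h3; omega)]
      convert (hG i).compl using 1
      ext a
      simp only [Set.mem_ofPred_eq, ne_eq, branch_eq_zero, hσ, Set.mem_compl_iff]
    -- A pendant edge cuts off one vertex, so the matrix has a single column.
    · rw [(branch_eq_one (i := i) (p := w.1)).2 (Prod.ext h2.symm (by simpa using h3.symm))]
      intro a ha a' ha' b hb b' hb' h1 h2
      simp only [Set.mem_ofPred_eq, ne_eq, not_not, branch_eq_one] at hb hb'
      obtain rfl : b = b' := D.L.injective (Subtype.ext (Subtype.ext (hb.trans hb'.symm)))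
      exact h1
  intro v w hvw
  cases hv : v.1.2 with
  | false =>
    rw [side_center hD (i := v.1.1) (Prod.ext rfl hv) hvw]
    exact key _ v w (Prod.ext rfl hv) hvw
  | true =>
    have hw : w.1 = (w.1.1, false) := by
      refine Prod.ext rfl ?_
      rw [hD.adj_iff, comb_adj, hv] at hvw
      simp at hvw
      exact hvw.2
    rw [side_branch hD hw hvw.symm]
    exact (key _ w v hw hvw.symm).compl

end RankDecomposition

/-! ### Linear rank-width at most one, and part (i). -/

section LinearRankWidth

variable {V : Type u} [Fintype V]

theorem exists_isThin_of_linearRankWidth_le_one {G : SimpleGraph V}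
    (h : linearRankWidth G ≤ 1) : ∃ f, IsThin G f := by
  by_cases hV : Fintype.card V ≤ 1
  · have := Fintype.card_le_one_iff_subsingleton.1 hV
    refine ⟨fun _ => 0, Function.injective_of_subsingleton _, fun k a _ a' _ b _ b' _ h1 _ => ?_⟩
    exact absurd (Subsingleton.elim a b) h1.ne
  · rw [linearRankWidth, if_neg hV] at h
    obtain ⟨m, hm⟩ : ∃ m, Fintype.card V = m + 1 := ⟨Fintype.card V - 1, by omega⟩
    -- The infimum of the empty set is `0`, so some linear decomposition is needed before the
    -- minimum is known to be attained.
    obtain ⟨D, hD, -⟩ := RankDecomposition.exists_isLinear (by omega) (Fintype.equivFinOfCardEq hm)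
    obtain ⟨D', hD', hw⟩ := Nat.sInf_mem
      (s := {k | ∃ D : RankDecomposition V, D.IsLinear ∧ D.width G = k}) ⟨_, D, hD, rfl⟩
    have := D'.finite_node
    obtain ⟨n, φ, hφ⟩ := exists_isCombEmbedding hD' D'.deg_le_three
    have hw' : D'.width G ≤ 1 := hw.le.trans h
    exact ⟨_, RankDecomposition.isThin_of_width_le_one hφ hw'⟩

theorem IsThin.linearRankWidth_le_one {G : SimpleGraph V} {f : V → ℕ} (hf : IsThin G f) :
    linearRankWidth G ≤ 1 := by
  by_cases hV : Fintype.card V ≤ 1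
  · rw [linearRankWidth, if_pos hV]; exact zero_le_one
  · rw [linearRankWidth, if_neg hV]
    obtain ⟨m, hm⟩ : ∃ m, Fintype.card V = m + 1 := ⟨Fintype.card V - 1, by omega⟩
    let _ : LinearOrder V := LinearOrder.lift' f hf.injective
    let σ := (Fintype.orderIsoFinOfCardEq V hm).symm
    have hσ : ∀ a b, σ a < σ b ↔ f a < f b := fun a b => σ.lt_iff_lt
    obtain ⟨D, hD, hw⟩ := RankDecomposition.exists_isLinear (by omega) σ.toEquiv
    refine le_trans (Nat.sInf_le (m := D.width G) ⟨D, hD, rfl⟩)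
      ((D.width_le_one_iff G).2 (hw G fun k => ?_))
    by_cases hk : k < m + 1
    · convert hf.cut (f (σ.symm ⟨k, hk⟩)) using 1
      ext a
      rw [Set.mem_ofPred_eq, Set.mem_ofPred_eq, ← hσ, OrderIso.apply_symm_apply]
      rfl
    · intro a _ a' _ b hb
      exact absurd ((σ b).2.trans_le (not_lt.1 hk)) hb

theorem isBipartite_and_linearRankWidth_le_one_iff (G : SimpleGraph V) :
    (G.IsBipartite ∧ linearRankWidth G ≤ 1) ↔ IsPivotMinorOfPath G := by
  constructor
  · rintro ⟨hG, h⟩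
    obtain ⟨f, hf⟩ := exists_isThin_of_linearRankWidth_le_one h
    exact hf.isPivotMinorOfPath hG
  · intro h
    obtain ⟨hG, f, hf⟩ := h.bipartite_thin
    exact ⟨hG, hf.linearRankWidth_le_one⟩

end LinearRankWidth

/-! ### Chains of three-vertex paths. -/

section TripleChain

/-- The infinite chain of three-vertex paths: the vertices `(i, 0)`, `(i, 1)`, `(i, 2)` induce a
path with middle vertex `(i, μ i)`, and `(i, 2)` is adjacent to `(i + 1, 0)`. -/
def tripleChain (μ : ℕ → ℕ) : SimpleGraph (ℕ × ℕ) where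
  Adj p q := (p.1 = q.1 ∧ p.2 ≠ q.2 ∧ (p.2 = μ p.1 ∨ q.2 = μ q.1)) ∨
    (p.1 + 1 = q.1 ∧ p.2 = 2 ∧ q.2 = 0) ∨ (q.1 + 1 = p.1 ∧ q.2 = 2 ∧ p.2 = 0)
  symm := ⟨fun p q h => by
    rcases h with ⟨h1, h2, h3⟩ | h | h
    · exact Or.inl ⟨h1.symm, h2.symm, h3.symm⟩
    · exact Or.inr (Or.inr h)
    · exact Or.inr (Or.inl h)⟩
  loopless := ⟨fun p h => by omega⟩

theorem tripleChain_adj (μ : ℕ → ℕ) (p q : ℕ × ℕ) : (tripleChain μ).Adj p q ↔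
    (p.1 = q.1 ∧ p.2 ≠ q.2 ∧ (p.2 = μ p.1 ∨ q.2 = μ q.1)) ∨
    (p.1 + 1 = q.1 ∧ p.2 = 2 ∧ q.2 = 0) ∨ (q.1 + 1 = p.1 ∧ q.2 = 2 ∧ p.2 = 0) :=
  Iff.rfl

theorem exists_neighbors_tripleChain {μ : ℕ → ℕ} {s : ℕ × ℕ} (hs : s.2 ≤ 2) :
    ∃ p q r : ℕ × ℕ, ∀ t, (tripleChain μ).Adj s t → t.2 ≤ 2 → t = p ∨ t = q ∨ t = r := by
  obtain ⟨i, j⟩ := s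
  have h3 : j = 0 ∨ j = 1 ∨ j = 2 := by
    dsimp only at hs
    omega
  rcases h3 with rfl | rfl | rfl
  · refine ⟨(i, 1), (i, 2), (i - 1, 2), fun t ht h2 => ?_⟩
    rw [tripleChain_adj] at ht
    simp only [Prod.ext_iff]
    omega
  · refine ⟨(i, 0), (i, 2), (i, 2), fun t ht h2 => ?_⟩
    rw [tripleChain_adj] at ht
    simp only [Prod.ext_iff]
    omega
  · refine ⟨(i, 0), (i, 1), (i + 1, 0), fun t ht h2 => ?_⟩
    rw [tripleChain_adj] at ht
    simp only [Prod.ext_iff]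
    omega

/-- `ψ` identifies `H` with the part of a chain of three-vertex paths strictly between `0`
and `m`. -/
structure IsTripleChainEmbedding {W : Type u} (H : SimpleGraph W) (m : ℕ) (μ : ℕ → ℕ)
    (ψ : W → ℕ × ℕ) : Prop where
  injective : Function.Injective ψ
  adj_iff : ∀ s t, H.Adj s t ↔ (tripleChain μ).Adj (ψ s) (ψ t)
  exists_eq : ∀ i j, 0 < i → i < m → j ≤ 2 → ∃ t, ψ t = (i, j)
  bounds : ∀ t, 0 < (ψ t).1 ∧ (ψ t).1 < m ∧ (ψ t).2 ≤ 2
  middle_le : ∀ i, 0 < i → i < m → μ i ≤ 2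

namespace IsTripleChainEmbedding

variable {W : Type u} {H : SimpleGraph W} {m : ℕ} {μ : ℕ → ℕ} {ψ : W → ℕ × ℕ}

theorem connected (h : IsTripleChainEmbedding H m μ ψ) (hm : 2 ≤ m) : H.Connected := by
  have hloc : ∀ s t, (ψ s).1 = (ψ t).1 → H.Reachable s t := by
    intro s t hst
    obtain ⟨c, hc⟩ := h.exists_eq (ψ s).1 (μ (ψ s).1) (h.bounds s).1 (h.bounds s).2.1
      (h.middle_le _ (h.bounds s).1 (h.bounds s).2.1)
    have key : ∀ r, (ψ r).1 = (ψ s).1 → H.Reachable c r := by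
      intro r hr
      by_cases hrc : (ψ r).2 = μ (ψ s).1
      · rw [h.injective (hc.trans (Prod.ext hr.symm hrc.symm))]
      · refine SimpleGraph.Adj.reachable ?_
        rw [h.adj_iff, tripleChain_adj, hc]
        exact Or.inl ⟨hr.symm, Ne.symm hrc, Or.inl rfl⟩
    exact (key s rfl).symm.trans (key t hst.symm)
  obtain ⟨s, hs⟩ := h.exists_eq 1 0 one_pos (by omega) (by omega)
  have hall : ∀ i t, (ψ t).1 = i + 1 → H.Reachable s t := by
    intro i
    induction i with
    | zero => exact fun t ht => hloc s t (by rw [hs, ht])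
    | succ i ih =>
      intro t ht
      have := (h.bounds t).2.1
      obtain ⟨a, ha⟩ := h.exists_eq (i + 1) 2 (by omega) (by omega) le_rfl
      obtain ⟨b, hb⟩ := h.exists_eq (i + 2) 0 (by omega) (by omega) (by omega)
      refine ((ih a (by rw [ha])).trans (SimpleGraph.Adj.reachable (v := b) ?_)).trans
        (hloc b t (by rw [hb, ht]))
      rw [h.adj_iff, tripleChain_adj, ha, hb]
      exact Or.inr (Or.inl ⟨rfl, rfl, rfl⟩)
  have hall : ∀ t, H.Reachable s t := fun t => hall ((ψ t).1 - 1) t (by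
    have := (h.bounds t).1
    omega)
  have : Nonempty W := ⟨s⟩
  exact ⟨fun a b => (hall a).symm.trans (hall b)⟩

theorem isEdgeCut_across (h : IsTripleChainEmbedding H m μ ψ) {u v : W}
    (hu : (ψ u).2 = 2) (hv : (ψ v).2 = 0) (huv : (ψ u).1 + 1 = (ψ v).1) :
    IsEdgeCut H {t | (ψ t).1 ≤ (ψ u).1} u v := by
  refine ⟨by rw [Set.mem_ofPred_eq], by rw [Set.mem_ofPred_eq]; omega, fun x y hxy hx hy => ?_⟩
  rw [Set.mem_ofPred_eq] at hx hy
  rw [h.adj_iff, tripleChain_adj] at hxy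
  exact ⟨h.injective (Prod.ext (by omega) (by omega)),
    h.injective (Prod.ext (by omega) (by omega))⟩

/-- With `v` the middle, `u` is an end of its three-vertex path. It is separated together with what
hangs on it: the earlier triples at index `0`, the later ones at index `2`, nothing at index `1`. -/
theorem isEdgeCut_within (h : IsTripleChainEmbedding H m μ ψ) {u v : W}
    (huv : (ψ u).1 = (ψ v).1) (hne : (ψ u).2 ≠ (ψ v).2) (hv : (ψ v).2 = μ (ψ v).1) :
    IsEdgeCut H {t | ψ t = ψ u ∨ ((ψ u).2 = 0 ∧ (ψ t).1 < (ψ u).1) ∨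
      ((ψ u).2 = 2 ∧ (ψ u).1 < (ψ t).1)} u v := by
  refine ⟨Or.inl rfl, ?_, fun x y hxy hx hy => ?_⟩
  · rw [Set.mem_ofPred_eq, Prod.ext_iff]; omega
  rw [Set.mem_ofPred_eq, Prod.ext_iff] at hx hy
  rw [h.adj_iff, tripleChain_adj] at hxy
  have key : (ψ x).1 = (ψ u).1 ∧ (ψ x).2 = (ψ u).2 ∧ (ψ y).1 = (ψ u).1 := by
    have := h.bounds x
    have := h.bounds y
    clear hv
    rcases hxy with ⟨h1, h2, -⟩ | h1 | h1 <;> omega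
  obtain ⟨h1, h2, h3⟩ := key
  refine ⟨h.injective (Prod.ext h1 h2), h.injective (Prod.ext (h3.trans huv) ?_)⟩
  rw [h1, h2, h3, huv, ← hv] at hxy
  omega

theorem isTree (h : IsTripleChainEmbedding H m μ ψ) (hm : 2 ≤ m) : H.IsTree := by
  refine isTree_of_isEdgeCut (h.connected hm) fun u v huv => ?_
  rw [h.adj_iff, tripleChain_adj] at huv
  rcases huv with ⟨h1, h2, h3 | h3⟩ | ⟨h1, h2, h3⟩ | ⟨h1, h2, h3⟩
  · exact ⟨_, Or.inr (h.isEdgeCut_within h1.symm h2.symm h3)⟩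
  · exact ⟨_, Or.inl (h.isEdgeCut_within h1 h2 h3)⟩
  · exact ⟨_, Or.inl (h.isEdgeCut_across h2 h3 h1)⟩
  · exact ⟨_, Or.inr (h.isEdgeCut_across h2 h3 h1)⟩

/-- Consecutive triples are joined only through the indices `2` and `0`, so the vertices with these
indices all lie on the path from `(1, 0)` to `(m - 1, 2)`. -/
theorem isCaterpillar (h : IsTripleChainEmbedding H m μ ψ) (hm : 2 ≤ m) : IsCaterpillar H := by
  obtain ⟨s, hs⟩ := h.exists_eq 1 0 one_pos (by omega) (by omega)
  obtain ⟨t, ht⟩ := h.exists_eq (m - 1) 2 (by omega) (by omega) le_rfl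
  have key : ∀ q, (ψ q).2 = 0 ∨ (ψ q).2 = 2 → q = s ∨ q = t ∨ ∃ C : Set W, s ∈ C ∧ t ∉ C ∧
      ∀ x y, H.Adj x y → x ∈ C → y ∉ C → x = q ∨ y = q := by
    intro q hq
    have hb := h.bounds q
    rcases hq with hq | hq
    · by_cases h1 : (ψ q).1 = 1
      · exact Or.inl (h.injective (hs ▸ Prod.ext h1 hq))
      refine Or.inr (Or.inr ⟨{r | (ψ r).1 < (ψ q).1}, ?_, ?_, fun x y hxy hx hy => Or.inr ?_⟩)
      · rw [Set.mem_ofPred_eq, hs]; simp only; omega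
      · rw [Set.mem_ofPred_eq, ht]; simp only; omega
      · rw [h.adj_iff, tripleChain_adj] at hxy
        rw [Set.mem_ofPred_eq] at hx hy
        exact h.injective (Prod.ext (by omega) (by omega))
    · by_cases h1 : (ψ q).1 = m - 1
      · exact Or.inr (Or.inl (h.injective (ht ▸ Prod.ext h1 hq)))
      refine Or.inr (Or.inr ⟨{r | (ψ r).1 ≤ (ψ q).1}, ?_, ?_, fun x y hxy hx hy => Or.inl ?_⟩)
      · rw [Set.mem_ofPred_eq, hs]; simp only; omega
      · rw [Set.mem_ofPred_eq, ht]; simp only; omega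
      · rw [h.adj_iff, tripleChain_adj] at hxy
        rw [Set.mem_ofPred_eq] at hx hy
        exact h.injective (Prod.ext (by omega) (by omega))
  refine isCaterpillar_of_separating (h.isTree hm) s t fun r => ?_
  have hb := h.bounds r
  by_cases hr : (ψ r).2 = 1
  · have hμ := h.middle_le _ hb.1 hb.2.1
    -- A vertex of index `1` is adjacent to index `0` if it is the middle, and to the middle
    -- otherwise.
    obtain ⟨q, hq⟩ := h.exists_eq (ψ r).1 (if μ (ψ r).1 = 1 then 0 else μ (ψ r).1) hb.1 hb.2.1
      (by split_ifs <;> omega)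
    refine ⟨q, Or.inr ?_, key q ?_⟩
    · rw [h.adj_iff, tripleChain_adj, hq]
      dsimp only
      split_ifs <;> omega
    · rw [hq]
      dsimp only
      split_ifs <;> omega
  · exact ⟨r, Or.inl rfl, key r (by omega)⟩

theorem deg_le_three (h : IsTripleChainEmbedding H m μ ψ) (t : W) : deg H t ≤ 3 := by
  obtain ⟨p, q, r, hpqr⟩ : ∃ p q r : ℕ × ℕ, ∀ s, H.Adj t s → ψ s = p ∨ ψ s = q ∨ ψ s = r := by
    have hadj : ∀ s, H.Adj t s → (tripleChain μ).Adj (ψ t) (ψ s) ∧ (ψ s).2 ≤ 2 :=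
      fun s hs => ⟨(h.adj_iff t s).1 hs, (h.bounds s).2.2⟩
    exact (exists_neighbors_tripleChain (h.bounds t).2.2).imp fun p => Exists.imp fun q =>
      Exists.imp fun r hr s hs => hr _ (hadj s hs).1 (hadj s hs).2
  rw [deg, ← Set.ncard_image_of_injective _ h.injective]
  have hsub : ψ '' H.neighborSet t ⊆ (({p, q, r} : Finset (ℕ × ℕ)) : Set (ℕ × ℕ)) := by
    rintro _ ⟨s, hs, rfl⟩
    simpa using hpqr s hs
  refine (Set.ncard_le_ncard hsub (Finset.finite_toSet _)).trans ?_
  rw [Set.ncard_coe_finset]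
  exact Finset.card_le_three

end IsTripleChainEmbedding

end TripleChain

/-! ### The links between the three parts at an inner node. -/

section Triple

variable {V : Type u} {G : SimpleGraph V}

/-- Three parts `A`, `B`, `C` of a bipartite graph across each of which the cut-rank is at most
one, with representatives `a` and `b` of the nonzero rows of `A` and `B`, one of which has a
neighbour in `C`: exactly two of the three pairs of parts are linked. -/
theorem exactly_two_of_three (hG : G.IsBipartite) {k : V → ℕ} {A B C : ℕ} (hAB : A ≠ B)
    (hAC : A ≠ C) (hBC : B ≠ C) (hk : ∀ x, k x = A ∨ k x = B ∨ k x = C)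
    (hcA : CutLeOne G {x | k x = A}) (hcB : CutLeOne G {x | k x = B})
    (hcC : CutLeOne G {x | k x ≠ C}) {a b : V} (ha : k a = A) (hb : k b = B)
    (hna : ∃ y, k y ≠ A ∧ G.Adj a y) (hnb : ∃ y, k y ≠ B ∧ G.Adj b y)
    (hab : (∃ y, k y = C ∧ G.Adj a y) ∨ ∃ y, k y = C ∧ G.Adj b y) :
    ((∃ y, k y = C ∧ G.Adj a y) ∧ (∃ y, k y = C ∧ G.Adj b y) ∧ ¬ G.Adj a b) ∨
    ((∃ y, k y = C ∧ G.Adj a y) ∧ ¬ (∃ y, k y = C ∧ G.Adj b y) ∧ G.Adj a b) ∨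
    (¬ (∃ y, k y = C ∧ G.Adj a y) ∧ (∃ y, k y = C ∧ G.Adj b y) ∧ G.Adj a b) := by
  -- If both see `C`, they have a common neighbour there, and an edge `ab` would close a triangle.
  have h1 : (∃ y, k y = C ∧ G.Adj a y) → (∃ y, k y = C ∧ G.Adj b y) → ¬ G.Adj a b := by
    rintro ⟨y, hy, hay⟩ ⟨z, hz, hbz⟩ h
    refine not_adj_of_isBipartite hG h hbz (hcC (a := a) ?_ (a' := b) ?_ (b := y) ?_ (b' := z) ?_
      hay hbz) <;> simp [*]
  -- An outside neighbour of `b` lies in `C` or in `A`; in the latter case rank one for `A` allows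
  -- it to be replaced by `a`.
  have h2 : (∃ y, k y = C ∧ G.Adj b y) ∨ G.Adj a b := by
    obtain ⟨y, hy, hby⟩ := hnb
    obtain ⟨z, hz, haz⟩ := hna
    rcases hk y with h | h | h
    · exact Or.inr (hcA (a := a) ha (a' := y) h (b := z) hz (b' := b)
        (by simp [hb, hAB.symm]) haz hby.symm)
    · exact absurd h hy
    · exact Or.inl ⟨y, h, hby⟩
  have h3 : (∃ y, k y = C ∧ G.Adj a y) ∨ G.Adj a b := by
    obtain ⟨y, hy, hby⟩ := hnb
    obtain ⟨z, hz, haz⟩ := hna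
    rcases hk z with h | h | h
    · exact absurd h hz
    · exact Or.inr (hcB (a := b) hb (a' := z) h (b := y) hy (b' := a)
        (by simp [ha, hAB]) hby haz.symm).symm
    · exact Or.inl ⟨z, h, haz⟩
  rcases hab with h | h
  · rcases h2 with h' | h'
    · exact Or.inl ⟨h, h', h1 h h'⟩
    · exact Or.inr (Or.inl ⟨h, fun h'' => h1 h h'' h', h'⟩)
  · rcases h3 with h' | h'
    · exact Or.inl ⟨h', h, h1 h' h⟩
    · exact Or.inr (Or.inr ⟨fun h'' => h1 h'' h h', h, h'⟩)

end Triple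

/-! ### Bases of row spaces of rank one. -/

section Rows

variable {V : Type u} {D : RankDecomposition V} {G : SimpleGraph V} {x : D.Node}
  {e : Sym2 D.Node}

theorem row_apply_ne_zero {a : V} (b : {b // b ∉ D.below x e}) :
    D.row x G e a b ≠ 0 ↔ G.Adj a b := by
  rw [RankDecomposition.row, SimpleGraph.adjMatrix_apply]
  simp

theorem row_ne_zero {a : V} : D.row x G e a ≠ 0 ↔ ∃ b, b ∉ D.below x e ∧ G.Adj a b := by
  rw [Function.ne_iff]
  constructor
  · rintro ⟨b, hb⟩
    exact ⟨b, b.2, (row_apply_ne_zero b).1 hb⟩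
  · rintro ⟨b, hb, h⟩
    exact ⟨⟨b, hb⟩, (row_apply_ne_zero _).2 h⟩

theorem row_eq_row (hcut : CutLeOne G (D.below x e)) {a a' : V} (ha : a ∈ D.below x e)
    (ha' : a' ∈ D.below x e) (h : D.row x G e a ≠ 0) (h' : D.row x G e a' ≠ 0) :
    D.row x G e a = D.row x G e a' := by
  obtain ⟨b, hb, hab⟩ := row_ne_zero.1 h
  obtain ⟨b', hb', hab'⟩ := row_ne_zero.1 h'
  have hZ : ∀ p q : ZMod 2, (p ≠ 0 ↔ q ≠ 0) → p = q := by decide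
  funext y
  refine hZ _ _ ?_
  rw [row_apply_ne_zero, row_apply_ne_zero]
  exact ⟨fun hy => hcut ha' ha hb' y.2 hab' hy, fun hy => hcut ha ha' hb y.2 hab hy⟩

namespace ExpansionData

variable (R : ExpansionData G D)

/-- Nonzero rows coincide, so an independent family has at most one member; a nonzero row to be
spanned forces one. -/
theorem exists_eq_singleton (he : e ∈ D.T.edgeSet) (hcut : CutLeOne G (D.below R.x e))
    (hne : ∃ a ∈ D.below R.x e, D.row R.x G e a ≠ 0) :
    ∃ a ∈ D.below R.x e, R.U e = {a} ∧ D.row R.x G e a ≠ 0 := by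
  have hli := R.linearIndependent e he
  have hU : ∀ a ∈ R.U e, D.row R.x G e a ≠ 0 := fun a ha => hli.ne_zero ⟨a, ha⟩
  obtain ⟨a, ha⟩ : (R.U e).Nonempty := by
    rw [Finset.nonempty_iff_ne_empty]
    intro h0
    obtain ⟨a, ha, hra⟩ := hne
    have := R.span e he a ha
    rw [h0] at this
    simp at this
    exact hra this
  refine ⟨a, R.subset_below e he ha, ?_, hU a ha⟩
  refine Finset.eq_singleton_iff_unique_mem.2 ⟨ha, fun b hb => ?_⟩
  have := hli.injective (a₁ := ⟨b, hb⟩) (a₂ := ⟨a, ha⟩) (row_eq_row hcut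
    (R.subset_below e he hb) (R.subset_below e he ha) (hU b hb) (hU a ha))
  exact congrArg Subtype.val this

theorem coeffNeZero_iff (hcut : CutLeOne G (D.below R.x e)) {a b : V}
    (ha : a ∈ D.below R.x e) (hb : b ∈ D.below R.x e) (hU : R.U e = {b})
    (hrb : D.row R.x G e b ≠ 0) :
    R.CoeffNeZero e a b ↔ D.row R.x G e a ≠ 0 := by
  constructor
  · rintro ⟨c, hc, hcb⟩
    rw [hU, Finset.sum_singleton] at hc
    rw [← hc]
    exact smul_ne_zero hcb hrb
  · intro h
    refine ⟨fun _ => 1, ?_, one_ne_zero⟩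
    rw [hU, Finset.sum_singleton, one_smul]
    exact row_eq_row hcut hb ha hrb h

end ExpansionData

end Rows

/-! ### Tree edges directed away from the root leaf, and existence of expansion data. -/

section Below

variable {V : Type u} {D : RankDecomposition V} {G : SimpleGraph V} {m : ℕ}
  {φ : D.Node → ℕ × Bool}

theorem IsCombEmbedding.eq_of_branch_eq {N : Type v} {T : SimpleGraph N} {φ : N → ℕ × Bool}
    (h : IsCombEmbedding T m φ) {i : ℕ} {v w w' : N}
    (hv : φ v = (i, false)) (hw : T.Adj v w) (hw' : T.Adj v w')
    (he : branch i (φ w) = branch i (φ w')) : w = w' := by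
  obtain ⟨h1, h2, h3⟩ := h.isEdgeCut hv hw
  exact ((h3 v w' hw' h1 (fun hn => hn he.symm)).2).symm

/-- Every edge can thus be examined by branches at an inner node; for `m = 1` the only edge joins
two leaves. -/
theorem IsCombEmbedding.exists_inner {N : Type v} {T : SimpleGraph N} {φ : N → ℕ × Bool}
    (h : IsCombEmbedding T m φ) (hm : 2 ≤ m) {e : Sym2 N} (he : e ∈ T.edgeSet) :
    ∃ i v w, φ v = (i, false) ∧ 0 < i ∧ i < m ∧ T.Adj v w ∧ e = s(v, w) := by
  induction e with | _ a b =>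
  rw [SimpleGraph.mem_edgeSet] at he
  have hab := he
  rw [h.adj_iff, comb_adj] at hab
  have ha1 := h.spine_le a
  have hb1 := h.spine_le b
  have ha2 := h.pendant a
  have hb2 := h.pendant b
  have key : ((φ a).2 = false ∧ 0 < (φ a).1 ∧ (φ a).1 < m) ∨
      ((φ b).2 = false ∧ 0 < (φ b).1 ∧ (φ b).1 < m) := by
    cases h1 : (φ a).2 <;> cases h2 : (φ b).2 <;> simp [h1, h2] at * <;> omega
  rcases key with ⟨h1, h2, h3⟩ | ⟨h1, h2, h3⟩
  · exact ⟨(φ a).1, a, b, Prod.ext rfl h1, h2, h3, he, rfl⟩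
  · exact ⟨(φ b).1, b, a, Prod.ext rfl h1, h2, h3, he.symm, Sym2.eq_swap⟩

namespace RankDecomposition

theorem full (h : IsCombEmbedding D.T m φ) : ∀ i, 0 < i → i < m → ∃ t, φ t = (i, true) :=
  h.full_of_isSubcubicTree D.subcubic

theorem one_le (h : IsCombEmbedding D.T m φ) : 1 ≤ m := by
  have := D.subcubic.2.1
  exact h.one_le

theorem exists_spine_of_not_isLeaf (h : IsCombEmbedding D.T m φ) {v : D.Node}
    (hv : ¬ IsLeaf D.T v) : ∃ i, φ v = (i, false) ∧ 0 < i ∧ i < m := by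
  rw [h.isLeaf_iff (one_le h) (full h), not_not] at hv
  exact ⟨_, Prod.ext rfl hv.1, hv.2⟩

theorem not_isLeaf (h : IsCombEmbedding D.T m φ) {v : D.Node} {i : ℕ} (hv : φ v = (i, false))
    (h0 : 0 < i) (hi : i < m) : ¬ IsLeaf D.T v := by
  rw [h.isLeaf_iff (one_le h) (full h), not_not, hv]
  exact ⟨rfl, h0, hi⟩

theorem branch_le_two (h : IsCombEmbedding D.T m φ) {x : D.Node} (hx : IsLeaf D.T x) {i : ℕ}
    (h0 : 0 < i) (hi : i < m) : branch i (φ x) ≤ 2 := by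
  have h1 := branch_le i (φ x)
  have h2 : branch i (φ x) ≠ 3 := fun e => not_isLeaf h (branch_eq_three.1 e) h0 hi hx
  omega

theorem exists_branch_eq (h : IsCombEmbedding D.T m φ) {i j : ℕ} (h0 : 0 < i) (hi : i < m)
    (hj : j ≤ 2) : ∃ a, branch i (φ (D.L a)) = j := by
  suffices ∃ t, IsLeaf D.T t ∧ branch i (φ t) = j by
    obtain ⟨t, ht, hb⟩ := this
    exact ⟨D.L.symm ⟨t, ht⟩, by rw [Equiv.apply_symm_apply]; exact hb⟩
  have hj : j = 0 ∨ j = 1 ∨ j = 2 := by omega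
  rcases hj with rfl | rfl | rfl
  · obtain ⟨t, ht⟩ := h.exists_spine 0 (Nat.zero_le m)
    exact ⟨t, h.isLeaf_of_spine_end (one_le h) (Or.inl ht), branch_eq_zero.2 (by rw [ht]; exact h0)⟩
  · obtain ⟨t, ht⟩ := full h i h0 hi
    exact ⟨t, h.isLeaf_of_pendant (by rw [ht]), branch_eq_one.2 ht⟩
  · obtain ⟨t, ht⟩ := h.exists_spine m le_rfl
    exact ⟨t, h.isLeaf_of_spine_end (one_le h) (Or.inr ht), branch_eq_two.2 (by rw [ht]; exact hi)⟩

theorem exists_adj_branch_eq (h : IsCombEmbedding D.T m φ) {i j : ℕ} {v : D.Node}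
    (hv : φ v = (i, false)) (h0 : 0 < i) (hi : i < m) (hj : j ≤ 2) :
    ∃ w, D.T.Adj v w ∧ branch i (φ w) = j := by
  have hj : j = 0 ∨ j = 1 ∨ j = 2 := by omega
  rcases hj with rfl | rfl | rfl
  · obtain ⟨t, ht⟩ := h.exists_spine (i - 1) (by omega)
    refine ⟨t, ?_, branch_eq_zero.2 (by rw [ht]; simp only; omega)⟩
    rw [h.adj_iff, hv, ht]
    exact Or.inl ⟨rfl, rfl, by simp only; omega⟩
  · obtain ⟨t, ht⟩ := full h i h0 hi
    refine ⟨t, ?_, branch_eq_one.2 ht⟩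
    rw [h.adj_iff, hv, ht, comb_adj]; simp
  · obtain ⟨t, ht⟩ := h.exists_spine (i + 1) (by omega)
    refine ⟨t, ?_, branch_eq_two.2 (by rw [ht]; simp only; omega)⟩
    rw [h.adj_iff, hv, ht]
    exact Or.inl ⟨rfl, rfl, Or.inl rfl⟩

theorem branch_ne_three_of_adj (h : IsCombEmbedding D.T m φ) {i : ℕ} {v w : D.Node}
    (hv : φ v = (i, false)) (hvw : D.T.Adj v w) : branch i (φ w) ≠ 3 := by
  intro e
  exact hvw.ne (h.injective (hv.trans (branch_eq_three.1 e).symm))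

theorem mem_below_iff (h : IsCombEmbedding D.T m φ) {x : D.Node} {i : ℕ} {v w : D.Node}
    (hv : φ v = (i, false)) (hvw : D.T.Adj v w) {a : V} : a ∈ D.below x s(v, w) ↔
      ¬ (branch i (φ x) = branch i (φ w) ↔ branch i (φ (D.L a)) = branch i (φ w)) := by
  rw [below, side_eq h hv hvw]
  rfl

theorem isTail_iff (h : IsCombEmbedding D.T m φ) {x : D.Node} {i : ℕ} {v w : D.Node}
    (hv : φ v = (i, false)) (hvw : D.T.Adj v w) :
    D.IsTail x s(v, w) v ↔ branch i (φ x) ≠ branch i (φ w) := by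
  have : branch i (φ v) ≠ branch i (φ w) := (h.isEdgeCut hv hvw).1
  rw [IsTail, h.reachable_iff hv hvw]
  simp [this]

theorem isHead_iff (h : IsCombEmbedding D.T m φ) {x : D.Node} {i : ℕ} {v w : D.Node}
    (hv : φ v = (i, false)) (hvw : D.T.Adj v w) :
    D.IsHead x s(v, w) v ↔ branch i (φ x) = branch i (φ w) := by
  have : branch i (φ v) ≠ branch i (φ w) := (h.isEdgeCut hv hvw).1
  rw [IsHead, h.reachable_iff hv hvw]
  simp [this]

theorem cutLeOne_branch [Fintype V] (h : IsCombEmbedding D.T m φ) (hw : D.width G ≤ 1) {i : ℕ}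
    {v w : D.Node} (hv : φ v = (i, false)) (hvw : D.T.Adj v w) :
    CutLeOne G {a | branch i (φ (D.L a)) ≠ branch i (φ w)} := by
  have := (D.width_le_one_iff G).1 hw v w hvw
  rwa [side_center h hv hvw] at this

theorem cutLeOne_below [Fintype V] (h : IsCombEmbedding D.T m φ) (hm : 2 ≤ m)
    (hw : D.width G ≤ 1) (x : D.Node) {e : Sym2 D.Node} (he : e ∈ D.T.edgeSet) :
    CutLeOne G (D.below x e) := by
  obtain ⟨i, v, w, hv, -, -, hvw, rfl⟩ := h.exists_inner hm he
  have := cutLeOne_branch h hw hv hvw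
  by_cases hx : branch i (φ x) = branch i (φ w)
  · convert this using 1
    ext a
    rw [mem_below_iff h hv hvw, Set.mem_ofPred_eq]
    simp [hx]
  · convert this.compl using 1
    ext a
    rw [mem_below_iff h hv hvw, Set.mem_compl_iff, Set.mem_ofPred_eq]
    simp [hx]

/-- Both sides of a tree edge carry vertices of `G`, so connectedness provides an edge across the
cut. -/
theorem exists_row_ne_zero (h : IsCombEmbedding D.T m φ) (hm : 2 ≤ m) (hG : G.Connected)
    (x : D.Node) {e : Sym2 D.Node} (he : e ∈ D.T.edgeSet) :
    ∃ a ∈ D.below x e, D.row x G e a ≠ 0 := by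
  obtain ⟨i, v, w, hv, h0, hi, hvw, rfl⟩ := h.exists_inner hm he
  have h3 := branch_ne_three_of_adj h hv hvw
  have h3' := branch_le i (φ w)
  obtain ⟨a, ha⟩ := exists_branch_eq h (j := branch i (φ w)) h0 hi (by omega)
  obtain ⟨b, hb⟩ := exists_branch_eq h (j := if branch i (φ w) = 0 then 1 else 0) h0 hi
    (by split_ifs <;> omega)
  have hb : branch i (φ (D.L b)) ≠ branch i (φ w) := by
    rw [hb]; split_ifs <;> omega
  have key : ∃ a b, a ∈ D.below x s(v, w) ∧ b ∉ D.below x s(v, w) := by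
    simp only [mem_below_iff h hv hvw, not_not]
    by_cases hx : branch i (φ x) = branch i (φ w)
    · exact ⟨b, a, by tauto, by tauto⟩
    · exact ⟨a, b, by tauto, by tauto⟩
  obtain ⟨a, b, ha, hb⟩ := key
  obtain ⟨p⟩ := hG.preconnected a b
  obtain ⟨d, -, h1, h2⟩ := p.exists_boundary_dart _ ha hb
  exact ⟨d.fst, h1, row_ne_zero.2 ⟨d.snd, h2, d.adj⟩⟩

theorem two_le [Fintype V] (h : IsCombEmbedding D.T m φ) (hV : 3 ≤ Fintype.card V)
    (hw : D.width G ≤ 1) : 2 ≤ m := by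
  have hle : ∀ a, (φ (D.L a)).1 < m + 1 := by
    intro a
    cases hb : (φ (D.L a)).2 with
    | false => exact Nat.lt_succ_of_le (h.spine_le _ hb)
    | true => have := (h.pendant _ hb).2; omega
  have := Fintype.card_le_of_injective (fun a => (⟨_, hle a⟩ : Fin (m + 1))) fun a b hab =>
    (isThin_of_width_le_one h hw).injective (congrArg Fin.val hab)
  rw [Fintype.card_fin] at this
  omega

/-- The head of `e` is the tail of `f`. -/
def IsParent (D : RankDecomposition V) (x : D.Node) (e f : Sym2 D.Node) : Prop :=
  e ∈ D.T.edgeSet ∧ f ∈ D.T.edgeSet ∧ ∃ v, D.IsHead x e v ∧ D.IsTail x f v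

theorem IsParent.exists_inner (h : IsCombEmbedding D.T m φ) {x : D.Node} {e f : Sym2 D.Node}
    (hef : D.IsParent x e f) : ∃ i v w w', φ v = (i, false) ∧ 0 < i ∧ i < m ∧ D.T.Adj v w ∧
      D.T.Adj v w' ∧ e = s(v, w) ∧ f = s(v, w') ∧ D.IsTail x f v ∧
      branch i (φ x) = branch i (φ w) ∧ branch i (φ x) ≠ branch i (φ w') := by
  obtain ⟨he, hf, v, ⟨hve, hhead⟩, hvf, htail⟩ := hef
  obtain ⟨w, rfl⟩ := hve
  obtain ⟨w', rfl⟩ := hvf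
  rw [SimpleGraph.mem_edgeSet] at he hf
  have hne : w ≠ w' := by
    rintro rfl
    exact hhead htail
  have hleaf : ¬ IsLeaf D.T v := by
    intro hl
    rw [IsLeaf, deg, Set.ncard_eq_one] at hl
    obtain ⟨c, hc⟩ := hl
    have h1 : w ∈ D.T.neighborSet v := he
    have h2 : w' ∈ D.T.neighborSet v := hf
    rw [hc, Set.mem_singleton_iff] at h1 h2
    exact hne (h1.trans h2.symm)
  obtain ⟨i, hv, h0, hi⟩ := exists_spine_of_not_isLeaf h hleaf
  exact ⟨i, v, w, w', hv, h0, hi, he, hf, rfl, rfl, ⟨Sym2.mem_mk_left _ _, htail⟩,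
    (isHead_iff h hv he).1 ⟨Sym2.mem_mk_left _ _, hhead⟩,
    (isTail_iff h hv hf).1 ⟨Sym2.mem_mk_left _ _, htail⟩⟩

theorem IsParent.below_ssubset (h : IsCombEmbedding D.T m φ) {x : D.Node} (hx : IsLeaf D.T x)
    {e f : Sym2 D.Node} (hef : D.IsParent x e f) : D.below x f ⊂ D.below x e := by
  obtain ⟨i, v, w, w', hv, h0, hi, hw, hw', rfl, rfl, -, h1, h2⟩ := hef.exists_inner h
  have hx2 := branch_le_two h hx h0 hi
  have h3 := branch_ne_three_of_adj h hv hw'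
  have h3' := branch_le i (φ w')
  -- The branch numbers `0`, `1`, `2` add up to `3`, so this is the third branch at `v`; its leaves
  -- lie below `e` but not below `f`.
  obtain ⟨a, ha⟩ := exists_branch_eq h (j := 3 - branch i (φ x) - branch i (φ w')) h0 hi (by omega)
  rw [Set.ssubset_iff_of_subset]
  · refine ⟨a, ?_, ?_⟩
    · rw [mem_below_iff h hv hw]; omega
    · rw [mem_below_iff h hv hw']; omega
  · intro b hb
    rw [mem_below_iff h hv hw'] at hb
    rw [mem_below_iff h hv hw]
    omega

/-- Since `f` is a bridge, only one of its ends is a tail, and only one edge at that end leads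
towards `x`. -/
theorem IsParent.unique (h : IsCombEmbedding D.T m φ) {x : D.Node} {e e' f : Sym2 D.Node}
    (he : D.IsParent x e f) (he' : D.IsParent x e' f) : e = e' := by
  obtain ⟨i, v, w, w', hv, h0, hi, hw, hw', rfl, rfl, ht, h1, h2⟩ := he.exists_inner h
  obtain ⟨j, y, z, z', hy, -, -, hz, hz', rfl, hf, ht', k1, k2⟩ := he'.exists_inner h
  have hvy : v = y := by
    by_contra hne
    have hy' : y = w' := by
      rcases Sym2.mem_iff.1 ht'.1 with h | h
      · exact absurd h.symm hne
      · exact h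
    subst hy'
    have hbr := SimpleGraph.isAcyclic_iff_forall_adj_isBridge.1 h.isTree.isAcyclic hw'
    rw [SimpleGraph.isBridge_iff] at hbr
    exact hbr (ht.2.symm.trans ht'.2)
  subst hvy
  obtain rfl : i = j := by
    rw [hv] at hy
    exact congrArg Prod.fst hy
  rw [h.eq_of_branch_eq hv hw hz (h1.symm.trans k1)]

/-- The recursion runs away from `x`, along strictly shrinking sets `A_e`: an edge inherits its
parent's representative whenever that vertex lies below it, and otherwise takes any vertex with a
nonzero row. -/
theorem exists_representatives [Fintype V] (h : IsCombEmbedding D.T m φ) (hm : 2 ≤ m)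
    (hG : G.Connected) {x : D.Node} (hx : IsLeaf D.T x) :
    ∃ u : Sym2 D.Node → V, (∀ e ∈ D.T.edgeSet, u e ∈ D.below x e ∧ D.row x G e (u e) ≠ 0) ∧
      ∀ e f, D.IsParent x e f → u e ∈ D.below x f → u f = u e := by
  classical
  have hV : Nonempty V := hG.nonempty
  have hpick : ∃ c : Sym2 D.Node → V,
      ∀ e ∈ D.T.edgeSet, c e ∈ D.below x e ∧ D.row x G e (c e) ≠ 0 := by
    have : ∀ e, ∃ a, e ∈ D.T.edgeSet → a ∈ D.below x e ∧ D.row x G e a ≠ 0 := by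
      intro e
      by_cases he : e ∈ D.T.edgeSet
      · obtain ⟨a, ha⟩ := exists_row_ne_zero h hm hG x he
        exact ⟨a, fun _ => ha⟩
      · exact ⟨hV.some, fun h => absurd h he⟩
    choose c hc using this
    exact ⟨c, hc⟩
  obtain ⟨c, hc⟩ := hpick
  have hwf : WellFounded fun e f => D.below x f ⊂ D.below x e :=
    InvImage.wf (D.below x) (wellFounded_gt (α := Set V))
  let u : Sym2 D.Node → V := hwf.fix fun f rec =>
    if H : ∃ e, ∃ hef : D.IsParent x e f, rec e (hef.below_ssubset h hx) ∈ D.below x f then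
      rec H.choose (H.choose_spec.choose.below_ssubset h hx) else c f
  have hu : ∀ f, u f = if H : ∃ e, D.IsParent x e f ∧ u e ∈ D.below x f then u H.choose
      else c f := by
    intro f
    have := hwf.fix_eq (C := fun _ => V) (fun f rec =>
      if H : ∃ e, ∃ hef : D.IsParent x e f, rec e (hef.below_ssubset h hx) ∈ D.below x f then
        rec H.choose (H.choose_spec.choose.below_ssubset h hx) else c f) f
    refine this.trans ?_
    by_cases H : ∃ e, D.IsParent x e f ∧ u e ∈ D.below x f
    · have H' : ∃ e, ∃ _ : D.IsParent x e f, u e ∈ D.below x f := by simpa using H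
      rw [dif_pos H, dif_pos H']
      exact congrArg u (H'.choose_spec.choose.unique h H.choose_spec.1)
    · have H' : ¬ ∃ e, ∃ _ : D.IsParent x e f, u e ∈ D.below x f := by simpa using H
      rw [dif_neg H, dif_neg H']
  refine ⟨u, fun f => ?_, fun e f hef hmem => ?_⟩
  · induction f using hwf.induction with
    | _ f ih =>
      intro hf
      rw [hu f]
      split_ifs with H
      · have hp := H.choose_spec.1
        refine ⟨H.choose_spec.2, ?_⟩
        -- An inherited row stays nonzero because the set of columns only grows away from `x`.
        obtain ⟨b, hb, hab⟩ := row_ne_zero.1 (ih _ (hp.below_ssubset h hx) hp.1).2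
        exact row_ne_zero.2 ⟨b, fun hb' => hb ((hp.below_ssubset h hx).subset hb'), hab⟩
      · exact hc f hf
  · have H : ∃ e, D.IsParent x e f ∧ u e ∈ D.below x f := ⟨e, hef, hmem⟩
    rw [hu f, dif_pos H]
    exact congrArg u (H.choose_spec.1.unique h hef)

theorem exists_expansionData [Fintype V] (h : IsCombEmbedding D.T m φ) (hm : 2 ≤ m)
    (hG : G.Connected) (hw : D.width G ≤ 1) {x : D.Node} (hx : IsLeaf D.T x) :
    ∃ R : ExpansionData G D, R.x = x := by
  obtain ⟨u, hu1, hu2⟩ := exists_representatives h hm hG hx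
  refine ⟨{ x := x
            isLeaf_x := hx
            U := fun e => {u e}
            subset_below := ?_
            linearIndependent := ?_
            span := ?_
            nested := ?_ }, rfl⟩
  · intro e he
    simpa using (hu1 e he).1
  · intro e he
    have : Unique {w // w ∈ ({u e} : Finset V)} :=
      ⟨⟨⟨u e, by simp⟩⟩, fun y => Subtype.ext (Finset.mem_singleton.1 y.2)⟩
    refine LinearIndependent.of_subsingleton default ?_
    have hd : ((default : {w // w ∈ ({u e} : Finset V)}) : V) = u e :=
      Finset.mem_singleton.1 (default : {w // w ∈ ({u e} : Finset V)}).2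
    rw [hd]
    exact (hu1 e he).2
  · intro e he a ha
    by_cases h0 : D.row x G e a = 0
    · rw [h0]; exact Submodule.zero_mem _
    · rw [row_eq_row (cutLeOne_below h hm hw x he) ha (hu1 e he).1 h0 (hu1 e he).2]
      exact Submodule.subset_span ⟨u e, by simp, rfl⟩
  · rintro e he f hf v hh ht a ⟨ha, haf⟩
    obtain rfl : a = u e := by simpa using ha
    simp [hu2 e f ⟨he, hf, v, hh, ht⟩ haf]

end RankDecomposition

end Below

/-! ### The rank-expansion is a chain of three-vertex paths. -/

section ExpansionGraph

namespace ExpansionData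

variable {V : Type u} {G : SimpleGraph V} {D : RankDecomposition V} (R : ExpansionData G D)

theorem graph_adj_of_node_ne {p q : R.Vertex} (hpq : p.1.2.2 ≠ q.1.2.2) :
    R.graph.Adj p q ↔ p.1.1 = q.1.1 ∧ p.1.2.1 = q.1.2.1 := by
  rw [graph, SimpleGraph.fromRel_adj]
  constructor
  · rintro ⟨-, h | h⟩
    · cases h with
      | inner ha he _ => exact ⟨ha, he⟩
      | through hv => exact absurd hv hpq
      | siblings hv => exact absurd hv hpq
    · cases h with
      | inner ha he _ => exact ⟨ha.symm, he.symm⟩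
      | through hv => exact absurd hv.symm hpq
      | siblings hv => exact absurd hv.symm hpq
  · rintro ⟨h1, h2⟩
    exact ⟨fun e => hpq (by rw [e]), Or.inl (.inner p q h1 h2 hpq)⟩

theorem graph_adj_of_node_eq {p q : R.Vertex} (hpq : p.1.2.2 = q.1.2.2)
    (hne : p.1.2.1 ≠ q.1.2.1) :
    R.graph.Adj p q ↔
      (D.IsTail R.x p.1.2.1 p.1.2.2 ∧ D.IsHead R.x q.1.2.1 q.1.2.2 ∧
        R.CoeffNeZero q.1.2.1 p.1.1 q.1.1) ∨
      (D.IsTail R.x q.1.2.1 q.1.2.2 ∧ D.IsHead R.x p.1.2.1 p.1.2.2 ∧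
        R.CoeffNeZero p.1.2.1 q.1.1 p.1.1) ∨
      (D.IsTail R.x p.1.2.1 p.1.2.2 ∧ D.IsTail R.x q.1.2.1 q.1.2.2 ∧ G.Adj p.1.1 q.1.1) := by
  rw [graph, SimpleGraph.fromRel_adj]
  constructor
  · rintro ⟨-, h | h⟩
    · cases h with
      | inner _ _ hv => exact absurd hpq hv
      | through _ h1 h2 h3 => exact Or.inl ⟨h1, h2, h3⟩
      | siblings _ _ h1 h2 h3 => exact Or.inr (Or.inr ⟨h1, h2, h3⟩)
    · cases h with
      | inner _ _ hv => exact absurd hpq.symm hv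
      | through _ h1 h2 h3 => exact Or.inr (Or.inl ⟨h1, h2, h3⟩)
      | siblings _ _ h1 h2 h3 => exact Or.inr (Or.inr ⟨h2, h1, h3.symm⟩)
  · intro h
    refine ⟨fun e => hne (by rw [e]), ?_⟩
    rcases h with ⟨h1, h2, h3⟩ | ⟨h1, h2, h3⟩ | ⟨h1, h2, h3⟩
    · exact Or.inl (.through p q hpq h1 h2 h3)
    · exact Or.inr (.through q p hpq.symm h1 h2 h3)
    · exact Or.inl (.siblings p q hpq hne h1 h2 h3)

variable {m : ℕ} {φ : D.Node → ℕ × Bool}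

theorem exists_representatives [Fintype V] (h : IsCombEmbedding D.T m φ) (hm : 2 ≤ m)
    (hG : G.Connected) (hw : D.width G ≤ 1) :
    ∃ u : Sym2 D.Node → V, ∀ e ∈ D.T.edgeSet, u e ∈ D.below R.x e ∧ R.U e = {u e} ∧
      D.row R.x G e (u e) ≠ 0 := by
  classical
  have hV : Nonempty V := hG.nonempty
  have : ∀ e, ∃ a, e ∈ D.T.edgeSet → a ∈ D.below R.x e ∧ R.U e = {a} ∧
      D.row R.x G e a ≠ 0 := by
    intro e
    by_cases he : e ∈ D.T.edgeSet
    · obtain ⟨a, ha⟩ := R.exists_eq_singleton he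
        (RankDecomposition.cutLeOne_below h hm hw R.x he)
        (RankDecomposition.exists_row_ne_zero h hm hG R.x he)
      exact ⟨a, fun _ => ha⟩
    · exact ⟨hV.some, fun h => absurd h he⟩
  choose u hu using this
  exact ⟨u, hu⟩

/-- At every inner vertex of the tree, the rank-expansion induces a path on three vertices. -/
theorem exists_middle [Fintype V] (h : IsCombEmbedding D.T m φ) (hm : 2 ≤ m)
    (hG : G.Connected) (hbip : G.IsBipartite) (hw : D.width G ≤ 1) {i : ℕ} {v : D.Node}
    (hv : φ v = (i, false)) (h0 : 0 < i) (hi : i < m) :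
    ∃ μ ≤ 2, ∀ (p q : R.Vertex) (w w' : D.Node), p.1.2 = (s(v, w), v) → q.1.2 = (s(v, w'), v) →
      D.T.Adj v w → D.T.Adj v w' → w ≠ w' →
        (R.graph.Adj p q ↔ branch i (φ w) = μ ∨ branch i (φ w') = μ) := by
  obtain ⟨u, hu⟩ := R.exists_representatives h hm hG hw
  set C := branch i (φ R.x) with hC
  have hC2 : C ≤ 2 := RankDecomposition.branch_le_two h R.isLeaf_x h0 hi
  -- `C` is the branch towards `x`; `A` and `B` are the two branches whose edges have tail `v`.
  obtain ⟨A, B, hA2, hB2, hAB, hAC, hBC⟩ : ∃ A B, A ≤ 2 ∧ B ≤ 2 ∧ A ≠ B ∧ A ≠ C ∧ B ≠ C :=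
    ⟨if C = 0 then 1 else 0, if C = 2 then 1 else 2, by split_ifs <;> omega,
      by split_ifs <;> omega, by split_ifs <;> omega, by split_ifs <;> omega,
      by split_ifs <;> omega⟩
  obtain ⟨wA, hwA, hbA⟩ := RankDecomposition.exists_adj_branch_eq h hv h0 hi hA2
  obtain ⟨wB, hwB, hbB⟩ := RankDecomposition.exists_adj_branch_eq h hv h0 hi hB2
  obtain ⟨wC, hwC, hbC⟩ := RankDecomposition.exists_adj_branch_eq h hv h0 hi hC2
  have hk : ∀ a, branch i (φ (D.L a)) = A ∨ branch i (φ (D.L a)) = B ∨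
      branch i (φ (D.L a)) = C := by
    intro a
    have := RankDecomposition.branch_le_two h (D.L a).2 h0 hi
    omega
  have hmem := fun w (hvw : D.T.Adj v w) a =>
    RankDecomposition.mem_below_iff (x := R.x) (a := a) h hv hvw
  have hedge : ∀ {w}, D.T.Adj v w → s(v, w) ∈ D.T.edgeSet := fun hvw => hvw
  have hkA : branch i (φ (D.L (u s(v, wA)))) = A := by
    have := (hmem wA hwA _).1 (hu _ (hedge hwA)).1
    rw [hbA] at this
    omega
  have hkB : branch i (φ (D.L (u s(v, wB)))) = B := by
    have := (hmem wB hwB _).1 (hu _ (hedge hwB)).1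
    rw [hbB] at this
    omega
  have hkC : branch i (φ (D.L (u s(v, wC)))) ≠ C := by
    have := (hmem wC hwC _).1 (hu _ (hedge hwC)).1
    rw [hbC] at this
    omega
  have hnb : ∀ w (hvw : D.T.Adj v w) a, D.row R.x G s(v, w) a ≠ 0 ↔
      ∃ y, (C = branch i (φ w) ↔ branch i (φ (D.L y)) = branch i (φ w)) ∧ G.Adj a y := by
    intro w hvw a
    rw [row_ne_zero]
    simp only [hmem w hvw, not_not]
    rfl
  have hnC : ∀ a, D.row R.x G s(v, wC) a ≠ 0 ↔ ∃ y, branch i (φ (D.L y)) = C ∧ G.Adj a y := by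
    intro a
    rw [hnb wC hwC, hbC]
    simp
  -- By nesting, the representative of the edge towards `x` is also the representative of the edge
  -- to `A` or to `B`, whichever branch contains it. So at least one of these two is linked to `C`.
  have hnested : ∀ w (hvw : D.T.Adj v w), branch i (φ w) ≠ C →
      u s(v, wC) ∈ D.below R.x s(v, w) → u s(v, wC) = u s(v, w) := by
    intro w hvw hwC' hmem'
    have := R.nested _ (hedge hwC) _ (hedge hvw) v
      ((RankDecomposition.isHead_iff h hv hwC).2 hbC.symm)
      ((RankDecomposition.isTail_iff h hv hvw).2 hwC'.symm)
      ⟨by rw [(hu _ (hedge hwC)).2.1]; simp, hmem'⟩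
    rw [(hu _ (hedge hvw)).2.1] at this
    simpa using this
  have htwo := exactly_two_of_three hbip (k := fun a => branch i (φ (D.L a))) hAB hAC hBC hk
    (a := u s(v, wA)) (b := u s(v, wB))
    (by
      have := (RankDecomposition.cutLeOne_branch h hw hv hwA).compl
      convert this using 1
      ext a
      simp [hbA])
    (by
      have := (RankDecomposition.cutLeOne_branch h hw hv hwB).compl
      convert this using 1
      ext a
      simp [hbB])
    (by
      have := RankDecomposition.cutLeOne_branch h hw hv hwC
      rwa [hbC] at this) hkA hkB
    (by
      obtain ⟨y, hy, hadj⟩ := (hnb wA hwA _).1 (hu _ (hedge hwA)).2.2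
      rw [hbA] at hy
      exact ⟨y, by omega, hadj⟩)
    (by
      obtain ⟨y, hy, hadj⟩ := (hnb wB hwB _).1 (hu _ (hedge hwB)).2.2
      rw [hbB] at hy
      exact ⟨y, by omega, hadj⟩)
    (by
      have hrow := (hnC _).1 (hu _ (hedge hwC)).2.2
      rcases hk (u s(v, wC)) with hc | hc | hc
      · rw [hnested wA hwA (by omega) ((hmem _ hwA _).2 (by rw [hbA]; omega))] at hrow
        exact Or.inl hrow
      · rw [hnested wB hwB (by omega) ((hmem _ hwB _).2 (by rw [hbB]; omega))] at hrow
        exact Or.inr hrow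
      · exact absurd hc hkC)
  simp only [← hnC] at htwo
  -- At `v` a link is of type `through` if one of the two tree edges leads towards `x`, and of type
  -- `siblings` otherwise.
  have hchar : ∀ (p q : R.Vertex) (w w' : D.Node), p.1.2 = (s(v, w), v) →
      q.1.2 = (s(v, w'), v) → D.T.Adj v w → D.T.Adj v w' → w ≠ w' →
      (R.graph.Adj p q ↔
        (branch i (φ w) ≠ C ∧ branch i (φ w') = C ∧ D.row R.x G s(v, wC) (u s(v, w)) ≠ 0) ∨
        (branch i (φ w') ≠ C ∧ branch i (φ w) = C ∧ D.row R.x G s(v, wC) (u s(v, w')) ≠ 0) ∨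
        (branch i (φ w) ≠ C ∧ branch i (φ w') ≠ C ∧ G.Adj (u s(v, w)) (u s(v, w')))) := by
    intro p q w w' hpw hqw hvw hvw' hne
    have hp1 : p.1.2.1 = s(v, w) := congrArg Prod.fst hpw
    have hp2 : p.1.2.2 = v := congrArg Prod.snd hpw
    have hq1 : q.1.2.1 = s(v, w') := congrArg Prod.fst hqw
    have hq2 : q.1.2.2 = v := congrArg Prod.snd hqw
    have hT := RankDecomposition.isTail_iff (x := R.x) h hv hvw
    have hT' := RankDecomposition.isTail_iff (x := R.x) h hv hvw'
    have hH := RankDecomposition.isHead_iff (x := R.x) h hv hvw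
    have hH' := RankDecomposition.isHead_iff (x := R.x) h hv hvw'
    have ha : p.1.1 = u s(v, w) := by
      have := p.2.2.2.2
      rw [hp1, (hu _ (hedge hvw)).2.1] at this
      exact Finset.mem_singleton.1 this
    have hb : q.1.1 = u s(v, w') := by
      have := q.2.2.2.2
      rw [hq1, (hu _ (hedge hvw')).2.1] at this
      exact Finset.mem_singleton.1 this
    have hcoeff : ∀ w w', D.T.Adj v w → D.T.Adj v w' → branch i (φ w) ≠ C →
        branch i (φ w') = C → (R.CoeffNeZero s(v, w') (u s(v, w)) (u s(v, w')) ↔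
          D.row R.x G s(v, wC) (u s(v, w)) ≠ 0) := by
      intro w w' hvw hvw' h1 h2
      obtain rfl := h.eq_of_branch_eq hv hvw' hwC (h2.trans hbC.symm)
      refine R.coeffNeZero_iff (RankDecomposition.cutLeOne_below h hm hw R.x (hedge hvw')) ?_
        (hu _ (hedge hvw')).1 (hu _ (hedge hvw')).2.1 (hu _ (hedge hvw')).2.2
      have := (hmem w hvw _).1 (hu _ (hedge hvw)).1
      rw [hmem _ hvw', h2]
      omega
    rw [R.graph_adj_of_node_eq (hp2.trans hq2.symm) (by
      rw [hp1, hq1]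
      intro he
      rcases Sym2.eq_iff.1 he with h | h
      · exact hne h.2
      · exact hne (h.2.trans h.1)), hp1, hp2, hq1, hq2, ha, hb]
    simp only [hT, hT', hH, hH', ← hC, ne_eq, eq_comm (a := C)]
    refine or_congr ?_ (or_congr ?_ Iff.rfl)
    · exact and_congr_right fun h1 => and_congr_right fun h2 => hcoeff w w' hvw hvw' h1 h2
    · exact and_congr_right fun h1 => and_congr_right fun h2 => hcoeff w' w hvw' hvw h1 h2
  have hw3 : ∀ w, D.T.Adj v w → w = wA ∨ w = wB ∨ w = wC := by
    intro w hvw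
    have h1 := RankDecomposition.branch_ne_three_of_adj h hv hvw
    have h2 := branch_le i (φ w)
    have h3 : branch i (φ w) = A ∨ branch i (φ w) = B ∨ branch i (φ w) = C := by omega
    rcases h3 with h3 | h3 | h3
    · exact Or.inl (h.eq_of_branch_eq hv hvw hwA (h3.trans hbA.symm))
    · exact Or.inr (Or.inl (h.eq_of_branch_eq hv hvw hwB (h3.trans hbB.symm)))
    · exact Or.inr (Or.inr (h.eq_of_branch_eq hv hvw hwC (h3.trans hbC.symm)))
  have hswap := G.adj_comm (u s(v, wB)) (u s(v, wA))
  have hBA := hAB.symm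
  have hCA := hAC.symm
  have hCB := hBC.symm
  -- The middle is the part that belongs to both linked pairs.
  rcases htwo with ⟨t1, t2, t3⟩ | ⟨t1, t2, t3⟩ | ⟨t1, t2, t3⟩
  · refine ⟨C, hC2, fun p q w w' hp hq hvw hvw' hne => ?_⟩
    rw [hchar p q w w' hp hq hvw hvw' hne]
    rcases hw3 w hvw with rfl | rfl | rfl <;> rcases hw3 w' hvw' with rfl | rfl | rfl <;>
    first
    | exact absurd rfl hne
    | simp [hbA, hbB, hbC, hAC, hBC, t1, t2, t3, hswap]
  · refine ⟨A, hA2, fun p q w w' hp hq hvw hvw' hne => ?_⟩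
    rw [hchar p q w w' hp hq hvw hvw' hne]
    rcases hw3 w hvw with rfl | rfl | rfl <;> rcases hw3 w' hvw' with rfl | rfl | rfl <;>
    first
    | exact absurd rfl hne
    | simp [hbA, hbB, hbC, hAC, hBC, hBA, hCA, t1, t2, t3, hswap]
  · refine ⟨B, hB2, fun p q w w' hp hq hvw hvw' hne => ?_⟩
    rw [hchar p q w w' hp hq hvw hvw' hne]
    rcases hw3 w hvw with rfl | rfl | rfl <;> rcases hw3 w' hvw' with rfl | rfl | rfl <;>
    first
    | exact absurd rfl hne
    | simp [hbA, hbB, hbC, hAB, hAC, hBC, hCB, t1, t2, t3, hswap]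

/-- As each `U e` is a singleton, a vertex `(a, e, v)` is determined by the spine index of `v` and
the branch at `v` into which `e` leads. A tree edge between consecutive inner nodes occurs twice, as
branch `2` of one and branch `0` of the next, and these two occurrences give the edge joining the
triples. -/
theorem exists_isTripleChainEmbedding [Fintype V] (h : IsCombEmbedding D.T m φ) (hm : 2 ≤ m)
    (hG : G.Connected) (hbip : G.IsBipartite) (hw : D.width G ≤ 1) :
    ∃ μ ψ, IsTripleChainEmbedding R.graph m μ ψ := by
  obtain ⟨u, hu⟩ := R.exists_representatives h hm hG hw
  have hmid : ∃ μ : ℕ → ℕ, ∀ i, 0 < i → i < m → μ i ≤ 2 ∧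
      ∀ (p q : R.Vertex) (v w w' : D.Node), φ v = (i, false) → p.1.2 = (s(v, w), v) →
        q.1.2 = (s(v, w'), v) → D.T.Adj v w → D.T.Adj v w' → w ≠ w' →
          (R.graph.Adj p q ↔ branch i (φ w) = μ i ∨ branch i (φ w') = μ i) := by
    have : ∀ i, ∃ c, 0 < i → i < m → c ≤ 2 ∧
        ∀ (p q : R.Vertex) (v w w' : D.Node), φ v = (i, false) → p.1.2 = (s(v, w), v) →
          q.1.2 = (s(v, w'), v) → D.T.Adj v w → D.T.Adj v w' → w ≠ w' →
            (R.graph.Adj p q ↔ branch i (φ w) = c ∨ branch i (φ w') = c) := by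
      intro i
      by_cases hi : 0 < i ∧ i < m
      · obtain ⟨v, hv⟩ := h.exists_spine i hi.2.le
        obtain ⟨c, hc, hadj⟩ := R.exists_middle h hm hG hbip hw hv hi.1 hi.2
        refine ⟨c, fun _ _ => ⟨hc, fun p q y w w' hy => ?_⟩⟩
        obtain rfl := h.injective (hv.trans hy.symm)
        exact hadj p q w w'
      · exact ⟨0, fun h1 h2 => absurd ⟨h1, h2⟩ hi⟩
    choose μ hμ using this
    exact ⟨μ, hμ⟩
  obtain ⟨μ, hμ⟩ := hmid
  have hdata : ∀ p : R.Vertex, ∃ i w, φ p.1.2.2 = (i, false) ∧ 0 < i ∧ i < m ∧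
      D.T.Adj p.1.2.2 w ∧ p.1.2.1 = s(p.1.2.2, w) := by
    rintro ⟨⟨a, e, v⟩, hl, he, hve, ha⟩
    dsimp only at hl he hve ha ⊢
    obtain ⟨w, rfl⟩ := hve
    obtain ⟨i, hv, h0, hi⟩ := RankDecomposition.exists_spine_of_not_isLeaf h hl
    exact ⟨i, w, hv, h0, hi, he, rfl⟩
  choose I W hI hI0 hIm hW hE using hdata
  have hrep : ∀ p : R.Vertex, p.1.1 = u p.1.2.1 := by
    rintro ⟨⟨a, e, v⟩, hl, he, hve, ha⟩
    dsimp only at hl he hve ha ⊢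
    rw [(hu e he).2.1] at ha
    simpa using ha
  have hnode : ∀ {p q : R.Vertex}, I p = I q → p.1.2.2 = q.1.2.2 := fun {p q} hpq =>
    h.injective ((hI p).trans (by rw [hpq, hI q]))
  have hext : ∀ {p q : R.Vertex}, p.1.2.2 = q.1.2.2 → W p = W q → p = q := by
    intro p q h1 h2
    have h3 : p.1.2.1 = q.1.2.1 := by rw [hE p, hE q, h1, h2]
    exact Subtype.ext (Prod.ext (by rw [hrep p, hrep q, h3]) (Prod.ext h3 h1))
  have hWeq : ∀ {p q : R.Vertex}, I p = I q →
      branch (I p) (φ (W p)) = branch (I q) (φ (W q)) → W p = W q := by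
    intro p q h1 h2
    rw [← h1] at h2
    exact h.eq_of_branch_eq (hI p) (hW p) (by rw [hnode h1]; exact hW q) h2
  have hnext : ∀ p q : R.Vertex, I p + 1 = I q →
      ((p.1.2.1 = q.1.2.1) ↔
        branch (I p) (φ (W p)) = 2 ∧ branch (I q) (φ (W q)) = 0) := by
    intro p q hpq
    have hadj : D.T.Adj p.1.2.2 q.1.2.2 := by
      rw [h.adj_iff, hI p, hI q]
      exact Or.inl ⟨rfl, rfl, Or.inl hpq⟩
    have hb1 : branch (I p) (φ q.1.2.2) = 2 := branch_eq_two.2 (by rw [hI q]; simp only; omega)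
    have hb2 : branch (I q) (φ p.1.2.2) = 0 := branch_eq_zero.2 (by rw [hI p]; simp only; omega)
    constructor
    · intro he
      rw [hE p, hE q] at he
      rcases Sym2.eq_iff.1 he with he | ⟨h1, h2⟩
      · exact absurd he.1 hadj.ne
      · rw [h2, ← h1]
        exact ⟨hb1, hb2⟩
    · rintro ⟨h1, h2⟩
      have e1 := h.eq_of_branch_eq (hI p) (hW p) hadj (h1.trans hb1.symm)
      have e2 := h.eq_of_branch_eq (hI q) (hW q) hadj.symm (h2.trans hb2.symm)
      rw [hE p, hE q, e1, e2]
      exact Sym2.eq_swap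
  refine ⟨μ, fun p => (I p, branch (I p) (φ (W p))), ?_, ?_, ?_, ?_, fun i h0 hi => (hμ i h0 hi).1⟩
  · intro p q hpq
    rw [Prod.mk.injEq] at hpq
    exact hext (hnode hpq.1) (hWeq hpq.1 hpq.2)
  · intro p q
    rw [tripleChain_adj]
    dsimp only
    by_cases hIpq : I p = I q
    · by_cases hWpq : W p = W q
      · obtain rfl := hext (hnode hIpq) hWpq
        refine iff_of_false R.graph.irrefl ?_
        omega
      · rw [(hμ (I p) (hI0 p) (hIm p)).2 p q p.1.2.2 (W p) (W q) (hI p)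
          (Prod.ext (hE p) rfl) (by rw [hnode hIpq]; exact Prod.ext (hE q) rfl) (hW p)
          (by rw [hnode hIpq]; exact hW q) hWpq]
        have := mt (hWeq hIpq) hWpq
        rw [← hIpq] at this ⊢
        omega
    · have hne : p.1.2.2 ≠ q.1.2.2 := fun he => hIpq (by
        have := hI p
        rw [he, hI q, Prod.mk.injEq] at this
        exact this.1.symm)
      have hiff : R.graph.Adj p q ↔ p.1.2.1 = q.1.2.1 := by
        rw [R.graph_adj_of_node_ne hne, and_iff_right_iff_imp]
        intro he
        rw [hrep p, hrep q, he]
      have hcons : p.1.2.1 = q.1.2.1 → I p + 1 = I q ∨ I q + 1 = I p := by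
        intro he
        rw [hE p, hE q] at he
        rcases Sym2.eq_iff.1 he with he | ⟨h1, h2⟩
        · exact absurd he.1 hne
        · have := hW p
          rw [h2, h.adj_iff, hI p, hI q, comb_adj] at this
          simpa using this
      rw [hiff]
      constructor
      · intro he
        rcases hcons he with hc | hc
        · exact Or.inr (Or.inl ⟨hc, (hnext p q hc).1 he⟩)
        · exact Or.inr (Or.inr ⟨hc, (hnext q p hc).1 he.symm⟩)
      · rintro (⟨h1, -⟩ | ⟨hc, h1⟩ | ⟨hc, h1⟩)
        · exact absurd h1 hIpq
        · exact (hnext p q hc).2 h1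
        · exact ((hnext q p hc).2 h1).symm
  · intro i j h0 hi hj
    obtain ⟨v, hv⟩ := h.exists_spine i hi.le
    obtain ⟨w, hvw, hb⟩ := RankDecomposition.exists_adj_branch_eq h hv h0 hi hj
    let p : R.Vertex := ⟨(u s(v, w), s(v, w), v),
      RankDecomposition.not_isLeaf h hv h0 hi, hvw, Sym2.mem_mk_left _ _, by
        simp [(hu s(v, w) hvw).2.1]⟩
    have h1 : I p = i := by
      have := hI p
      rw [show p.1.2.2 = v from rfl, hv, Prod.mk.injEq] at this
      exact this.1.symm
    have h2 : W p = w := (Sym2.congr_right.1 (hE p)).symm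
    exact ⟨p, by rw [h1, h2, hb]⟩
  · intro p
    have h1 := branch_le (I p) (φ (W p))
    have h2 := RankDecomposition.branch_ne_three_of_adj h (hI p) (hW p)
    exact ⟨hI0 p, hIm p, by dsimp only; omega⟩

end ExpansionData

end ExpansionGraph
end RankExpansion

theorem mainTheorem6 {V : Type u} [Fintype V] (G : SimpleGraph V) :
    ((G.IsBipartite ∧ RankExpansion.linearRankWidth G ≤ 1) ↔
      RankExpansion.IsPivotMinorOfPath G) ∧
    (G.IsBipartite → G.Connected → 3 ≤ Fintype.card V →
      ∀ D : RankExpansion.RankDecomposition V, D.IsLinear → D.width G ≤ 1 →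
        (∀ x : D.Node, RankExpansion.IsLeaf D.T x →
          ∃ R : RankExpansion.ExpansionData G D, R.x = x) ∧
        ∀ R : RankExpansion.ExpansionData G D,
          RankExpansion.IsCaterpillar R.graph ∧ ∀ p, RankExpansion.deg R.graph p ≤ 3) ∧
    (∀ (W : Type v) [Finite W] (H : SimpleGraph W), RankExpansion.IsCaterpillar H →
      (∀ w, RankExpansion.deg H w ≤ 3) → RankExpansion.IsPivotMinorOfPath H) := by
  refine ⟨RankExpansion.isBipartite_and_linearRankWidth_le_one_iff G, ?_,
    fun W _ H hH hdeg => RankExpansion.isPivotMinorOfPath_of_isCaterpillar hH hdeg⟩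
  intro hbip hG hV D hD hw
  have := D.finite_node
  obtain ⟨m, φ, h⟩ := RankExpansion.exists_isCombEmbedding hD D.deg_le_three
  have hm := RankExpansion.RankDecomposition.two_le h hV hw
  refine ⟨fun x hx => RankExpansion.RankDecomposition.exists_expansionData h hm hG hw hx,
    fun R => ?_⟩
  obtain ⟨μ, ψ, hψ⟩ := R.exists_isTripleChainEmbedding h hm hG hbip hw
  exact ⟨hψ.isCaterpillar hm, hψ.deg_le_three⟩
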